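/- A \emph{barrier} (or \emph{opaque set}) for a set $U\subseteq\mathbb R^2$ is a set $B\subseteq\mathbb R^2$ that intersects every straight line that intersects $U$ (no part of $B$ is required to lie in $U$, and $B$ need not be connected). A barrier $B$ is \emph{rectifiable} if it is the union $B=\bigcup_i\beta_i$ of countably many (finitely or infinitely many) continuous curves $\beta_i\colon[0,1]\to\mathbb R^2$, each of finite length $|\beta_i|$ (the total variation of $\beta_i$ for the Euclidean distance), such that the sum $\sum_i|\beta_i|$ converges; this sum is the length of the family. Let $\square=[-\tfrac12,\tfrac12]^2$ be the closed unit square. \textbf{Theorem.} Every rectifiable barrier of the unit square has total length at least $2.00002$. That is, if $(\beta_i)_i$ is a countable family of curves of finite length whose sum of lengths converges and whose union meets every straight line that meets $\square$, then $$\sum_i|\beta_i|\ \ge\ 2.00002 .$$ In particular this holds when the curves are pairwise disjoint except at their endpoints, in which case the sum is called the length $|B|$ of $B$. -/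

import Mathlib

/-- The Euclidean plane. -/
abbrev Plane : Type := EuclideanSpace ℝ (Fin 2)

/-- A (parametrized, continuous, compact) curve in the plane. -/
abbrev PlaneCurve : Type := C(unitInterval, Plane)

/-- The length of a curve, i.e. its total variation for the Euclidean distance: the supremum of the
lengths of the inscribed polygonal lines. It may be infinite. -/
noncomputable def PlaneCurve.length (β : PlaneCurve) : ENNReal :=
  eVariationOn (fun t : unitInterval => β t) Set.univ

/-- The closed, axis-aligned unit square centred at the origin. -/
def unitSquare : Set Plane :=
  {p | |p 0| ≤ 1 / 2 ∧ |p 1| ≤ 1 / 2}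

/-- An affine subspace of the plane is a straight line if it is one-dimensional. -/
def IsStraightLine (ℓ : AffineSubspace ℝ Plane) : Prop :=
  Module.finrank ℝ ℓ.direction = 1

/-- `B` is a barrier (opaque set) for `U`: it intersects every straight line that intersects `U`. -/
def IsBarrier (B U : Set Plane) : Prop :=
  ∀ ℓ : AffineSubspace ℝ Plane, IsStraightLine ℓ →
    ((ℓ : Set Plane) ∩ U).Nonempty → ((ℓ : Set Plane) ∩ B).Nonempty

/-- The union of the curves of a family, as a set of points. -/
def curveUnion {ι : Type*} (β : ι → PlaneCurve) : Set Plane :=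
  ⋃ i, Set.range (β i)

/-- Every curve of the family has finite length, and the sum of the lengths converges. The curves
are allowed to meet each other; families of curves that are pairwise disjoint except at the
endpoints are a special case. -/
def IsRectifiableFamily {ι : Type*} (β : ι → PlaneCurve) : Prop :=
  (∀ i, (β i).length ≠ ⊤) ∧ Summable fun i => (β i).length.toReal

/-- The total length of a family of curves: the sum of their lengths. It is meant for families
that satisfy `IsRectifiableFamily`. -/
noncomputable def totalLength {ι : Type*} (β : ι → PlaneCurve) : ℝ :=
  ∑' i, (β i).length.toReal

open MeasureTheory Set
open scoped NNReal

universe u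

/-! Along the lines `m * x + n * y = t` the square casts a shadow of length `|m| + |n|`, so the
shadows of the pieces of a barrier, counted with multiplicity, have at least that total length. The
two diagonal directions give `∑ max |dx| |dy| ≥ 2`, hence length at least 2. If the length were at
most 2.00002, equality would nearly hold: almost all of the length is nearly horizontal or nearly
vertical, the extents in `x` and in `y` each sum to about 1, little of either lies beyond the
square, and the shadows, integrated over slopes in `[-3, 3]`, overlap very little
(`integral_excess_le`).

Overlap is nevertheless forced. When the slope runs from -3 to 3, the shadows of steep segments on
the right of the square pass those of steep segments on the left, and the integrated overlap is at
least the product of the two masses divided by the horizontal spread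
(`mul_mass_le_integral_overlap`). Hence one of the left and right sides has few steep segments, and
by symmetry one of the top and bottom sides has few flat ones (`IsNearBarrier.exists_steepMass_le`).
The lines that cut off the corner between these two poor sides can then be met only by those few
segments, by tilted segments and by parts outside the square (`corner_contribution_le`), which is
not enough (`IsNearBarrier.length_gt`).

All this is done for finitely many segments that miss only a small measure of lines in each
direction. Replacing curves by chords and dropping a tail of the family reduces the theorem to that
case (`IsRectifiableFamily.exists_isNearBarrier`). -/

/-- The mass to the left of `t` of the family of intervals `[c j, c j + w j]`, `j ∈ T`. -/
def load {κ : Type*} (T : Finset κ) (c w : κ → ℝ) (t : ℝ) : ℝ :=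
  ∑ j ∈ T, max 0 (min (w j) (t - c j))

/-- The mass to the left of `p` after the intervals `[c j, c j + w j]` have been pushed to the left
until they no longer overlap. -/
noncomputable def parked {κ : Type*} (T : Finset κ) (c w : κ → ℝ) (p : ℝ) : ℝ :=
  ⨆ τ : ℝ≥0, (load T c w (p + τ) - τ)

/-! ### Pushing overlapping intervals apart on the line. -/

section Parking

variable {κ : Type*} {T : Finset κ} {c w : κ → ℝ}

lemma load_nonneg (t : ℝ) : 0 ≤ load T c w t :=
  Finset.sum_nonneg fun _ _ => le_max_left _ _

lemma load_mono : Monotone (load T c w) := by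
  intro s t hst
  refine Finset.sum_le_sum fun j _ => ?_
  gcongr

lemma load_le (hw : ∀ j ∈ T, 0 ≤ w j) (t : ℝ) : load T c w t ≤ ∑ j ∈ T, w j :=
  Finset.sum_le_sum fun j hj => max_le (hw j hj) (min_le_left _ _)

lemma load_eq_sum (hw : ∀ j ∈ T, 0 ≤ w j) {t : ℝ} (h : ∀ j ∈ T, c j + w j ≤ t) :
    load T c w t = ∑ j ∈ T, w j := by
  refine Finset.sum_congr rfl fun j hj => ?_
  rw [min_eq_left (by linarith [h j hj]), max_eq_right (hw j hj)]

lemma load_eq_zero {t : ℝ} (h : ∀ j ∈ T, t ≤ c j) : load T c w t = 0 := by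
  refine Finset.sum_eq_zero fun j hj => ?_
  rw [max_eq_left]
  exact (min_le_right _ _).trans (by linarith [h j hj])

lemma load_add_le_of_mem {j : κ} (hj : j ∈ T) {p q : ℝ} (hpq : p ≤ q)
    (hp : c j ≤ p) (hq : q ≤ c j + w j) : load T c w p + (q - p) ≤ load T c w q := by
  classical
  unfold load
  rw [← Finset.add_sum_erase _ _ hj, ← Finset.add_sum_erase _ (fun j => max 0 (min (w j) (q - c j))) hj]
  have h1 : ∑ i ∈ T.erase j, max 0 (min (w i) (p - c i)) ≤
      ∑ i ∈ T.erase j, max 0 (min (w i) (q - c i)) :=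
    Finset.sum_le_sum fun i _ => by gcongr
  have h2 : max 0 (min (w j) (p - c j)) = p - c j := by
    rw [min_eq_right (by linarith), max_eq_right (by linarith)]
  have h3 : max 0 (min (w j) (q - c j)) = q - c j := by
    rw [min_eq_right (by linarith), max_eq_right (by linarith)]
  rw [h2, h3]
  linarith

lemma bddAbove_parked (hw : ∀ j ∈ T, 0 ≤ w j) (p : ℝ) :
    BddAbove (range fun τ : ℝ≥0 => load T c w (p + τ) - τ) := by
  refine ⟨∑ j ∈ T, w j, ?_⟩
  rintro _ ⟨τ, rfl⟩
  have := load_le (c := c) hw (p + τ)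
  have := τ.coe_nonneg
  simp only
  linarith

lemma le_parked (hw : ∀ j ∈ T, 0 ≤ w j) (p : ℝ) {τ : ℝ} (hτ : 0 ≤ τ) :
    load T c w (p + τ) - τ ≤ parked T c w p :=
  le_ciSup (bddAbove_parked hw p) (⟨τ, hτ⟩ : ℝ≥0)

lemma parked_le {p b : ℝ} (h : ∀ τ : ℝ, 0 ≤ τ → load T c w (p + τ) - τ ≤ b) :
    parked T c w p ≤ b :=
  ciSup_le fun τ => h τ τ.coe_nonneg

lemma load_le_parked (hw : ∀ j ∈ T, 0 ≤ w j) (p : ℝ) : load T c w p ≤ parked T c w p := by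
  simpa using le_parked (c := c) hw p le_rfl

lemma parked_nonneg (hw : ∀ j ∈ T, 0 ≤ w j) (p : ℝ) : 0 ≤ parked T c w p :=
  (load_nonneg p).trans (load_le_parked hw p)

lemma parked_le_sum (hw : ∀ j ∈ T, 0 ≤ w j) (p : ℝ) : parked T c w p ≤ ∑ j ∈ T, w j :=
  parked_le fun τ hτ => by linarith [load_le (c := c) hw (p + τ)]

lemma parked_mono (hw : ∀ j ∈ T, 0 ≤ w j) : Monotone (parked T c w) := by
  intro p q hpq
  refine parked_le fun τ hτ => ?_
  have := load_mono (T := T) (c := c) (w := w) (show p + τ ≤ q + τ by linarith)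
  linarith [le_parked (c := c) hw q hτ]

/-- Parked mass has density at most one, whereas the slope of `load` is the multiplicity of the
overlap. This is why parking is used: `k` intervals crossing `m` others would cost `k * m` with
`load`, which the excess multiplicity `k + m - 1` does not control. -/
lemma parked_add_le (hw : ∀ j ∈ T, 0 ≤ w j) (p : ℝ) {η : ℝ} (hη : 0 ≤ η) :
    parked T c w (p + η) ≤ parked T c w p + η := by
  refine parked_le fun τ hτ => ?_
  have := le_parked (c := c) hw p (add_nonneg hη hτ)
  rw [← add_assoc] at this
  linarith

/-- Parking never empties a place that was occupied. A delay `τ ≥ η` at `p` is a delay `τ - η` at `p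
+ η`; for `τ ≤ η` the load itself grows with slope at least one. -/
lemma parked_add_ge_of_mem (hw : ∀ j ∈ T, 0 ≤ w j) {j : κ} (hj : j ∈ T) {p η : ℝ}
    (hp : c j ≤ p) (hq : p + η ≤ c j + w j) : parked T c w p + η ≤ parked T c w (p + η) := by
  suffices parked T c w p ≤ parked T c w (p + η) - η by linarith
  refine parked_le fun τ hτ => ?_
  rcases le_total η τ with h | h
  · have := le_parked (c := c) hw (p + η) (sub_nonneg.2 h)
    rw [show p + η + (τ - η) = p + τ by ring] at this
    linarith
  · have h1 := load_add_le_of_mem (c := c) (w := w) hj (show p + τ ≤ p + η by linarith) (by linarith) hq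
    linarith [load_le_parked (c := c) hw (p + η)]

lemma parked_eq_sum (hw : ∀ j ∈ T, 0 ≤ w j) {p : ℝ} (h : ∀ j ∈ T, c j + w j ≤ p) :
    parked T c w p = ∑ j ∈ T, w j :=
  le_antisymm (parked_le_sum hw p) ((load_eq_sum hw h).ge.trans (load_le_parked hw p))

/-- Parking shifts mass by at most the total mass, so a gap of that width stays empty. -/
lemma parked_eq_zero (hw : ∀ j ∈ T, 0 ≤ w j) {p : ℝ} (h : ∀ j ∈ T, p + ∑ i ∈ T, w i ≤ c j) :
    parked T c w p = 0 := by
  refine le_antisymm (parked_le fun τ hτ => ?_) (parked_nonneg hw p)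
  rcases le_total τ (∑ i ∈ T, w i) with h1 | h1
  · rw [load_eq_zero fun j hj => by linarith [h j hj]]
    linarith
  · linarith [load_le (c := c) hw (p + τ)]

lemma continuous_parked (hw : ∀ j ∈ T, 0 ≤ w j) : Continuous (parked T c w) := by
  have : LipschitzWith 1 (parked T c w) := by
    refine LipschitzWith.of_le_add fun p q => ?_
    rcases le_total p q with h | h
    · linarith [parked_mono (c := c) hw h, dist_nonneg (x := p) (y := q)]
    · have := parked_add_le (c := c) hw q (sub_nonneg.2 h)
      rw [add_sub_cancel] at this
      rw [Real.dist_eq, abs_of_nonneg (sub_nonneg.2 h)]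
      exact this
  exact this.continuous

/-- Integrated against another family of intervals, an increment of the parked mass is controlled by
the total overlap of the two families. -/
lemma sum_integral_parked_sub_le [DecidableEq κ] {A : Finset κ} (hwA : ∀ i ∈ A, 0 ≤ w i)
    (hw : ∀ j ∈ T, 0 ≤ w j) {η : ℝ} (hη : 0 ≤ η) :
    ∑ i ∈ A, ∫ p in (c i)..(c i + w i), (parked T c w (p + η) - parked T c w p) ≤
      η * (∑ i ∈ A, w i + ∑ j ∈ T, w j
        - volume.real (⋃ k ∈ A ∪ T, Icc (c k) (c k + w k)) + T.card * η) := by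
  set φ : ℝ → ℝ := fun p => parked T c w (p + η) - parked T c w p with hφ
  have hφc : Continuous φ := by
    have := continuous_parked (c := c) hw
    fun_prop
  have hφ0 : ∀ p, 0 ≤ φ p := fun p => sub_nonneg.2 (parked_mono hw (by linarith))
  have hφη : ∀ p, φ p ≤ η := fun p => by
    have := parked_add_le (c := c) hw p hη
    simp only [hφ]; linarith
  obtain ⟨R, hR0, hR⟩ : ∃ R : ℝ, 0 ≤ R ∧ ∀ k ∈ A ∪ T, -R ≤ c k ∧ c k + w k ≤ R := by
    refine ⟨∑ k ∈ A ∪ T, (|c k| + |w k|), by positivity, fun k hk => ?_⟩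
    have := Finset.single_le_sum (f := fun k => |c k| + |w k|) (fun i _ => by positivity) hk
    have h1 := neg_abs_le (c k)
    have h2 := le_abs_self (c k)
    have h3 := le_abs_self (w k)
    have h4 := abs_nonneg (w k)
    constructor <;> linarith
  set μ : Measure ℝ := volume.restrict (Icc (-R) R) with hμ
  set U : Set ℝ := ⋃ k ∈ A ∪ T, Icc (c k) (c k + w k) with hU
  have hUm : MeasurableSet U := Finset.measurableSet_biUnion _ fun _ _ => measurableSet_Icc
  have hUR : U ⊆ Icc (-R) R := by
    intro p hp
    simp only [hU, mem_iUnion, mem_Icc] at hp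
    obtain ⟨k, hk, h1, h2⟩ := hp
    exact ⟨by linarith [(hR k hk).1], by linarith [(hR k hk).2]⟩
  -- the pointwise inequality
  have hpt : ∀ p : ℝ, ∑ i ∈ A, (Icc (c i) (c i + w i)).indicator φ p + U.indicator (fun _ => η) p ≤
      ∑ i ∈ A, (Icc (c i) (c i + w i)).indicator (fun _ => η) p + φ p +
        ∑ j ∈ T, (Ioc (c j + w j - η) (c j + w j)).indicator (fun _ => η) p := by
    intro p
    have hedge : 0 ≤ ∑ j ∈ T, (Ioc (c j + w j - η) (c j + w j)).indicator (fun _ => η) p :=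
      Finset.sum_nonneg fun j _ => indicator_nonneg (fun _ _ => hη) _
    have hle : ∀ i, (Icc (c i) (c i + w i)).indicator φ p ≤
        (Icc (c i) (c i + w i)).indicator (fun _ => η) p := fun i =>
      indicator_le_indicator (hφη p)
    have hUle : U.indicator (fun _ => η) p ≤ η := by
      by_cases h : p ∈ U <;> simp [h, hη]
    -- On an interval of `A`, one copy of `φ` cancels against the free `φ` and one copy of `η` pays
    -- for `U`. Elsewhere in `U` an interval of `T` gives `φ ≥ η`, except within `η` of its right
    -- end; the last sum pays for that.
    by_cases hA : ∃ i ∈ A, p ∈ Icc (c i) (c i + w i)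
    · obtain ⟨i, hi, hpi⟩ := hA
      rw [← Finset.add_sum_erase _ _ hi,
        ← Finset.add_sum_erase _ (fun i => (Icc (c i) (c i + w i)).indicator (fun _ => η) p) hi]
      have := Finset.sum_le_sum fun k (_ : k ∈ A.erase i) => hle k
      simp only [indicator_of_mem hpi] at this ⊢
      linarith
    · push Not at hA
      rw [Finset.sum_eq_zero fun i hi => indicator_of_notMem (hA i hi) _,
        Finset.sum_eq_zero fun i hi => indicator_of_notMem (hA i hi) _]
      by_cases hp : p ∈ U
      · simp only [hU, mem_iUnion, Finset.mem_union] at hp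
        obtain ⟨j, hj | hj, hpj⟩ := hp
        · exact absurd hpj (hA j hj)
        · by_cases hpe : p ≤ c j + w j - η
          · have := parked_add_ge_of_mem (c := c) (η := η) hw hj hpj.1 (by linarith)
            have : η ≤ φ p := by simp only [hφ]; linarith
            linarith
          · have h1 := Finset.single_le_sum
              (f := fun j => (Ioc (c j + w j - η) (c j + w j)).indicator (fun _ => η) p)
              (fun k _ => indicator_nonneg (fun _ _ => hη) _) hj
            rw [indicator_of_mem (show p ∈ Ioc (c j + w j - η) (c j + w j) from
              ⟨not_le.1 hpe, hpj.2⟩)] at h1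
            linarith [hφ0 p]
      · rw [indicator_of_notMem hp]
        linarith [hφ0 p]
  have hφi : Integrable φ μ := hφc.integrableOn_Icc
  have hci : Integrable (fun _ : ℝ => η) μ := integrable_const η
  have i1 : Integrable (fun p => ∑ i ∈ A, (Icc (c i) (c i + w i)).indicator φ p) μ :=
    integrable_finsetSum A fun i _ => hφi.indicator measurableSet_Icc
  have i2 : Integrable (U.indicator fun _ => η) μ := hci.indicator hUm
  have i3 : Integrable (fun p => ∑ i ∈ A, (Icc (c i) (c i + w i)).indicator (fun _ => η) p) μ :=
    integrable_finsetSum A fun i _ => hci.indicator measurableSet_Icc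
  have i4 : Integrable
      (fun p => ∑ j ∈ T, (Ioc (c j + w j - η) (c j + w j)).indicator (fun _ => η) p) μ :=
    integrable_finsetSum T fun j _ => hci.indicator measurableSet_Ioc
  have i5 : Integrable
      (fun p => ∑ i ∈ A, (Icc (c i) (c i + w i)).indicator (fun _ => η) p + φ p) μ := i3.add hφi
  have hint := integral_mono (i1.add i2) (i5.add i4) hpt
  simp only [Pi.add_apply] at hint
  rw [integral_add i1 i2, integral_add i5 i4, integral_add i3 hφi,
    integral_finsetSum _ fun i _ => hφi.indicator measurableSet_Icc,
    integral_finsetSum _ fun i _ => hci.indicator measurableSet_Icc,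
    integral_finsetSum _ fun i _ => hci.indicator measurableSet_Ioc] at hint
  have e1 : ∀ i ∈ A, ∫ p, (Icc (c i) (c i + w i)).indicator φ p ∂μ =
      ∫ p in (c i)..(c i + w i), φ p := by
    intro i hi
    have := hR i (Finset.mem_union_left _ hi)
    rw [integral_indicator measurableSet_Icc, hμ, Measure.restrict_restrict measurableSet_Icc,
      inter_eq_left.2 (Icc_subset_Icc this.1 this.2),
      intervalIntegral.integral_of_le (by linarith [hwA i hi]), integral_Icc_eq_integral_Ioc]
  have e2 : ∫ p, U.indicator (fun _ => η) p ∂μ = η * volume.real U := by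
    rw [integral_indicator hUm, hμ, Measure.restrict_restrict hUm, inter_eq_left.2 hUR]
    simp [mul_comm]
  have e3 : ∀ i ∈ A, ∫ p, (Icc (c i) (c i + w i)).indicator (fun _ => η) p ∂μ = η * w i := by
    intro i hi
    have := hR i (Finset.mem_union_left _ hi)
    rw [integral_indicator measurableSet_Icc, hμ, Measure.restrict_restrict measurableSet_Icc,
      inter_eq_left.2 (Icc_subset_Icc this.1 this.2)]
    simp [hwA i hi, mul_comm]
  have e4 : ∀ j ∈ T, ∫ p, (Ioc (c j + w j - η) (c j + w j)).indicator (fun _ => η) p ∂μ ≤ η * η := by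
    intro j hj
    rw [integral_indicator measurableSet_Ioc, hμ, Measure.restrict_restrict measurableSet_Ioc]
    simp only [integral_const, smul_eq_mul, MeasurableSet.univ, measureReal_restrict_apply, univ_inter]
    refine mul_le_mul_of_nonneg_right ?_ hη
    refine (measureReal_mono (inter_subset_left) (by simp)).trans ?_
    simp [hη]
  -- The integral of a difference of translates telescopes to the two ends of the window.
  have e5 : ∫ p, φ p ∂μ ≤ η * ∑ j ∈ T, w j := by
    have hi : ∀ a b : ℝ, IntervalIntegrable (parked T c w) volume a b := fun a b =>
      (continuous_parked hw).intervalIntegrable a b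
    rw [hμ, integral_Icc_eq_integral_Ioc, ← intervalIntegral.integral_of_le (by linarith),
      hφ, intervalIntegral.integral_sub (Continuous.intervalIntegrable
        (by have := continuous_parked (c := c) hw; fun_prop) _ _) (hi _ _),
      intervalIntegral.integral_comp_add_right (fun p => parked T c w p),
      intervalIntegral.integral_interval_sub_interval_comm' (hi _ _) (hi _ _) (hi _ _)]
    have h1 : ∫ p in R..(R + η), parked T c w p ≤ ∫ p in R..(R + η), ∑ j ∈ T, w j :=
      intervalIntegral.integral_mono_on (by linarith) (hi _ _) (by simp) fun p _ =>
        parked_le_sum hw p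
    have h2 : 0 ≤ ∫ p in (-R)..(-R + η), parked T c w p :=
      intervalIntegral.integral_nonneg (by linarith) fun p _ => parked_nonneg hw p
    simp only [intervalIntegral.integral_const, smul_eq_mul, add_sub_cancel_left] at h1
    linarith
  rw [Finset.sum_congr rfl e1, e2, Finset.sum_congr rfl e3, ← Finset.mul_sum] at hint
  have e6 := Finset.sum_le_sum e4
  simp only [Finset.sum_const, nsmul_eq_mul] at e6
  have : η * (∑ i ∈ A, w i + ∑ j ∈ T, w j - volume.real U + T.card * η) =
    η * ∑ i ∈ A, w i + η * ∑ j ∈ T, w j - η * volume.real U + T.card * (η * η) := by ring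
  rw [this]
  linarith

end Parking

/-! ### Sweeping one group of intervals past another. -/

/-- A function whose increments are at most `g s * h + C * h ^ 2` grows at most by the integral of
the Lipschitz function `g`. -/
lemma sub_le_integral_of_increment_le {f g : ℝ → ℝ} {a b C K : ℝ} (hab : a ≤ b)
    (hg : Continuous g) (hK : ∀ s t, g s ≤ g t + K * |s - t|)
    (hf : ∀ s h, a ≤ s → 0 ≤ h → s + h ≤ b → f (s + h) - f s ≤ g s * h + C * h ^ 2) :
    f b - f a ≤ ∫ s in a..b, g s := by
  have hi : ∀ u v : ℝ, IntervalIntegrable g volume u v := fun u v => hg.intervalIntegrable u v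
  have hK0 : 0 ≤ K := by
    have h1 := hK 0 1
    have h2 := hK 1 0
    norm_num at h1 h2
    linarith
  set Z : ℝ → ℝ := fun s => f s - ∫ t in a..s, g t with hZ
  have hstep : ∀ s h, a ≤ s → 0 ≤ h → s + h ≤ b → Z (s + h) - Z s ≤ (C + K) * h ^ 2 := by
    intro s h hs hh hsb
    have h1 : (∫ t in a..(s + h), g t) - ∫ t in a..s, g t = ∫ t in s..(s + h), g t :=
      intervalIntegral.integral_interval_sub_left (hi _ _) (hi _ _)
    have h2 : ∫ t in s..(s + h), (g s - K * h) ≤ ∫ t in s..(s + h), g t := by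
      refine intervalIntegral.integral_mono_on (by linarith) (by simp) (hi _ _) fun t ht => ?_
      have h3 := hK s t
      have h4 : |s - t| ≤ h := by
        rw [abs_sub_comm, abs_of_nonneg (sub_nonneg.2 ht.1)]; linarith [ht.2]
      have := mul_le_mul_of_nonneg_left h4 hK0
      linarith
    simp only [intervalIntegral.integral_const, add_sub_cancel_left, smul_eq_mul] at h2
    have h5 := hf s h hs hh hsb
    simp only [hZ]
    nlinarith
  -- Telescoping over `N` equal steps leaves an error of order `1 / N`.
  have hN : ∀ N : ℕ, 0 < N → Z b - Z a ≤ (C + K) * (b - a) ^ 2 / N := by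
    intro N hN
    have hN' : (0 : ℝ) < N := by exact_mod_cast hN
    set h : ℝ := (b - a) / N with hh
    have hh0 : 0 ≤ h := div_nonneg (sub_nonneg.2 hab) hN'.le
    have hNh : N * h = b - a := by rw [hh]; field_simp
    have key : ∀ k : ℕ, k ≤ N → Z (a + k * h) - Z a ≤ k * ((C + K) * h ^ 2) := by
      intro k
      induction k with
      | zero => intro; simp
      | succ k ih =>
        intro hk
        have h1 := ih (by omega)
        have hk' : ((k + 1 : ℕ) : ℝ) * h ≤ N * h :=
          mul_le_mul_of_nonneg_right (by exact_mod_cast hk) hh0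
        push_cast at hk' ⊢
        have h2 := hstep (a + k * h) h (by have : 0 ≤ k * h := by positivity
                                           linarith) hh0 (by linarith)
        rw [show a + (k + 1) * h = a + k * h + h by ring]
        linarith
    have := key N le_rfl
    rw [hNh, add_sub_cancel] at this
    refine this.trans_eq ?_
    rw [hh]
    field_simp
  have hlim : Filter.Tendsto (fun N : ℕ => (C + K) * (b - a) ^ 2 / (N : ℝ)) Filter.atTop (nhds 0) :=
    tendsto_const_div_atTop_nhds_zero_nat _
  have := ge_of_tendsto hlim (Filter.eventually_atTop.2 ⟨1, fun N h => hN N h⟩)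
  simp only [hZ, intervalIntegral.integral_same] at this
  linarith

section Overlap

variable {κ : Type*}

/-- Parked mass depends only on the offsets `p - c j` and increases with them, so the motion of the
intervals is dominated by a shift of the observation point. -/
lemma parked_comp_shift_le {T : Finset κ} {c c' w : κ → ℝ} (hw : ∀ j ∈ T, 0 ≤ w j) {p p' d : ℝ}
    (h : ∀ j ∈ T, p' - c' j ≤ p - c j + d) :
    parked T c' w p' ≤ parked T c w (p + d) := by
  refine parked_le fun τ hτ => ?_
  refine le_trans ?_ (le_parked hw (p + d) hτ)
  refine sub_le_sub_right (Finset.sum_le_sum fun j hj => ?_) _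
  have := h j hj
  gcongr max 0 (min _ ?_)
  linarith

/-- Two groups of vertical segments, one to the left of the other, that are seen along lines of
slope `s`. When the slope varies so much that the second group passes the first one, then the
projections must overlap for a considerable time. -/
theorem mul_mass_le_integral_overlap [DecidableEq κ] {A B : Finset κ} {x y w : κ → ℝ} {S D K : ℝ}
    {W : ℝ → ℝ} (hS : 0 ≤ S) (hD : 0 ≤ D) (hA : ∀ i ∈ A, 0 ≤ w i) (hB : ∀ j ∈ B, 0 ≤ w j)
    (hxD : ∀ i ∈ A, ∀ j ∈ B, x j ≤ x i + D)
    (hstart : ∀ i ∈ A, ∀ j ∈ B, y i + S * x i + w i + ∑ k ∈ B, w k ≤ y j + S * x j)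
    (hend : ∀ i ∈ A, ∀ j ∈ B, y j - S * x j + w j ≤ y i - S * x i)
    (hWc : Continuous W) (hWK : ∀ s t, W s ≤ W t + K * |s - t|)
    (hW : ∀ s, -S ≤ s → s ≤ S → ∑ i ∈ A, w i + ∑ j ∈ B, w j - volume.real
      (⋃ k ∈ A ∪ B, Icc (y k - s * x k) (y k - s * x k + w k)) ≤ W s) :
    (∑ i ∈ A, w i) * ∑ j ∈ B, w j ≤ D * ∫ s in (-S)..S, W s := by
  set c : ℝ → κ → ℝ := fun s k => y k - s * x k with hc
  -- `Θ` measures how much of `B`, once parked, lies below `A`. It rises from 0 to the product of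
  -- the masses, and its growth rate is at most `D` times the overlap.
  set Θ : ℝ → ℝ := fun s => ∑ i ∈ A, ∫ p in (c s i)..(c s i + w i), parked B (c s) w p with hΘ
  have hi : ∀ s a b, IntervalIntegrable (parked B (c s) w) volume a b := fun s a b =>
    (continuous_parked hB).intervalIntegrable a b
  have hend' : Θ S = (∑ i ∈ A, w i) * ∑ j ∈ B, w j := by
    rw [Finset.sum_mul]
    refine Finset.sum_congr rfl fun i hiA => ?_
    have hw := hA i hiA
    have : EqOn (parked B (c S) w) (fun _ => ∑ j ∈ B, w j) (uIcc (c S i) (c S i + w i)) := by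
      intro p hp
      rw [uIcc_of_le (by linarith)] at hp
      exact parked_eq_sum hB fun j hj => (hend i hiA j hj).trans hp.1
    rw [intervalIntegral.integral_congr this]
    simp
  have hstart' : Θ (-S) = 0 := by
    refine Finset.sum_eq_zero fun i hiA => ?_
    have hw := hA i hiA
    have : EqOn (parked B (c (-S)) w) (fun _ => 0) (uIcc (c (-S) i) (c (-S) i + w i)) := by
      intro p hp
      rw [uIcc_of_le (by linarith)] at hp
      refine parked_eq_zero hB fun j hj => ?_
      have h1 := hstart i hiA j hj
      have h2 := hp.2
      simp only [hc] at h2 ⊢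
      linarith
    rw [intervalIntegral.integral_congr this]
    simp
  have hstep : ∀ s h, -S ≤ s → 0 ≤ h → s + h ≤ S →
      Θ (s + h) - Θ s ≤ (D * W s) * h + (B.card * D ^ 2) * h ^ 2 := by
    intro s h hs hh hsh
    -- Relative to a point carried along with an interval of `A`, those of `B` descend by at most `D
    -- * h`.
    have h1 : Θ (s + h) ≤ ∑ i ∈ A, ∫ p in (c s i)..(c s i + w i), parked B (c s) w (p + D * h) := by
      refine Finset.sum_le_sum fun i hiA => ?_
      have e1 : ∫ p in (c (s + h) i)..(c (s + h) i + w i), parked B (c (s + h)) w p =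
          ∫ θ in (0 : ℝ)..(w i), parked B (c (s + h)) w (θ + c (s + h) i) := by
        rw [intervalIntegral.integral_comp_add_right (fun p => parked B (c (s + h)) w p), zero_add,
          add_comm (w i)]
      have e2 : ∫ p in (c s i)..(c s i + w i), parked B (c s) w (p + D * h) =
          ∫ θ in (0 : ℝ)..(w i), parked B (c s) w (θ + c s i + D * h) := by
        rw [intervalIntegral.integral_comp_add_right (fun p => parked B (c s) w (p + D * h)),
          zero_add, add_comm (w i)]
      rw [e1, e2]
      have hc1 := continuous_parked (c := c (s + h)) hB
      have hc2 := continuous_parked (c := c s) hB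
      refine intervalIntegral.integral_mono_on (hA i hiA)
        (Continuous.intervalIntegrable (by fun_prop) _ _)
        (Continuous.intervalIntegrable (by fun_prop) _ _) fun θ _ => ?_
      refine parked_comp_shift_le hB fun j hj => ?_
      have := mul_le_mul_of_nonneg_right (hxD i hiA j hj) hh
      simp only [hc]
      linarith
    have h2 : Θ (s + h) - Θ s ≤ ∑ i ∈ A, ∫ p in (c s i)..(c s i + w i),
        (parked B (c s) w (p + D * h) - parked B (c s) w p) := by
      have hc2 := continuous_parked (c := c s) hB
      have : ∀ i ∈ A, ∫ p in (c s i)..(c s i + w i),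
          (parked B (c s) w (p + D * h) - parked B (c s) w p) =
          (∫ p in (c s i)..(c s i + w i), parked B (c s) w (p + D * h)) -
            ∫ p in (c s i)..(c s i + w i), parked B (c s) w p := fun i _ =>
        intervalIntegral.integral_sub (Continuous.intervalIntegrable (by fun_prop) _ _) (hi _ _ _)
      rw [Finset.sum_congr rfl this, Finset.sum_sub_distrib]
      linarith
    have h3 := sum_integral_parked_sub_le (c := c s) hA hB (mul_nonneg hD hh)
    have h4 := mul_le_mul_of_nonneg_left (hW s hs (by linarith)) (mul_nonneg hD hh)
    simp only [hc] at h2 h3 h4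
    refine h2.trans (h3.trans ?_)
    rw [mul_add]
    nlinarith
  have := sub_le_integral_of_increment_le (f := Θ) (g := fun s => D * W s) (K := D * K)
    (by linarith : -S ≤ S) (by fun_prop) (fun s t => by
      have := mul_le_mul_of_nonneg_left (hWK s t) hD
      rw [mul_add, ← mul_assoc] at this
      exact this) hstep
  rw [hend', hstart', sub_zero, intervalIntegral.integral_const_mul] at this
  exact this

end Overlap

/-! ### Inequalities for a single segment with increments `a` and `b`. -/

section PlaneVectors

lemma integral_abs_sub_mul_of_le {a b S : ℝ} (hS : 0 ≤ S) (h : S * |a| ≤ |b|) :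
    ∫ s in (-S)..S, |b - s * a| = 2 * S * |b| := by
  have hs : ∀ s ∈ uIcc (-S) S, |s * a| ≤ |b| := by
    intro s hs
    rw [uIcc_of_le (by linarith)] at hs
    rw [abs_mul]
    exact (mul_le_mul_of_nonneg_right (abs_le.2 hs) (abs_nonneg a)).trans h
  rcases le_total 0 b with hb | hb
  · rw [intervalIntegral.integral_congr (g := fun s => b - s * a) fun s hs' => by
      have := abs_le.1 (hs s hs')
      rw [abs_of_nonneg hb] at this
      simp only
      rw [abs_of_nonneg (by linarith)]]
    rw [intervalIntegral.integral_sub (by simp) (Continuous.intervalIntegrable (by fun_prop) _ _),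
      intervalIntegral.integral_mul_const]
    simp [abs_of_nonneg hb]
    left
    ring
  · rw [intervalIntegral.integral_congr (g := fun s => s * a - b) fun s hs' => by
      have := abs_le.1 (hs s hs')
      rw [abs_of_nonpos hb] at this
      simp only
      rw [abs_of_nonpos (by linarith)]
      ring]
    rw [intervalIntegral.integral_sub (Continuous.intervalIntegrable (by fun_prop) _ _) (by simp),
      intervalIntegral.integral_mul_const]
    simp [abs_of_nonpos hb]
    left
    ring

lemma hasDerivAt_mul_abs_self (x : ℝ) : HasDerivAt (fun x : ℝ => x * |x|) (2 * |x|) x := by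
  rcases lt_trichotomy x 0 with h | rfl | h
  · have h1 : HasDerivAt (fun x : ℝ => -(x ^ 2)) (2 * |x|) x :=
      (hasDerivAt_pow 2 x).neg.congr_deriv (by simp [abs_of_neg h])
    refine h1.congr_of_eventuallyEq ?_
    filter_upwards [eventually_lt_nhds h] with z hz
    rw [abs_of_neg hz]; ring
  · rw [hasDerivAt_iff_isLittleO]
    simp only [abs_zero, mul_zero, sub_zero, smul_zero]
    rw [Asymptotics.isLittleO_iff]
    intro ε hε
    filter_upwards [Metric.ball_mem_nhds (0 : ℝ) hε] with z hz
    rw [Metric.mem_ball, dist_zero_right, Real.norm_eq_abs] at hz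
    rw [norm_mul, Real.norm_eq_abs, Real.norm_eq_abs, abs_abs]
    exact mul_le_mul_of_nonneg_right hz.le (abs_nonneg z)
  · have h1 : HasDerivAt (fun x : ℝ => x ^ 2) (2 * |x|) x :=
      (hasDerivAt_pow 2 x).congr_deriv (by simp [abs_of_pos h])
    refine h1.congr_of_eventuallyEq ?_
    filter_upwards [eventually_gt_nhds h] with z hz
    rw [abs_of_pos hz]; ring

lemma integral_abs_sub_mul_of_ge {a b S : ℝ} (ha : a ≠ 0) (h : |b| ≤ S * |a|) :
    ∫ s in (-S)..S, |b - s * a| = S ^ 2 * |a| + b ^ 2 / |a| := by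
  have hd : ∀ s ∈ uIcc (-S) S,
      HasDerivAt (fun s => -((b - s * a) * |b - s * a|) / (2 * a)) |b - s * a| s := by
    intro s _
    have h1 : HasDerivAt (fun s => b - s * a) (-a) s := by
      simpa using ((hasDerivAt_id s).mul_const a).const_sub b
    have h2 := (((hasDerivAt_mul_abs_self (b - s * a)).comp s h1).neg).div_const (2 * a)
    refine h2.congr_deriv ?_
    field_simp
  rw [intervalIntegral.integral_eq_sub_of_hasDerivAt hd
    (Continuous.intervalIntegrable (by fun_prop) _ _)]
  have hb := abs_le.1 h
  rcases ha.lt_or_gt with ha' | ha'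
  · rw [abs_of_neg ha'] at hb ⊢
    rw [abs_of_nonneg (show 0 ≤ b - S * a by linarith),
      abs_of_nonpos (show b - -S * a ≤ 0 by linarith)]
    field_simp
    ring
  · rw [abs_of_pos ha'] at hb ⊢
    rw [abs_of_nonpos (show b - S * a ≤ 0 by linarith),
      abs_of_nonneg (show 0 ≤ b - -S * a by linarith)]
    field_simp
    ring

/-- Axis-parallel vectors give equality (6 + 9 = 15), and the square's shadows integrate to 30 over
the same slopes. This family of directions therefore also gives the bound 2, and length above 2
bounds the integrated overlap. -/
lemma integral_abs_add_integral_abs_le (a b : ℝ) :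
    (∫ s in (-3 : ℝ)..3, |b - s * a|) + ∫ s in (-3 : ℝ)..3, |a - s * b| ≤
      15 * √(a ^ 2 + b ^ 2) := by
  wlog hab : |a| ≤ |b| generalizing a b
  · rw [add_comm, add_comm (a ^ 2)]
    exact this b a (le_of_not_ge hab)
  rcases eq_or_ne b 0 with rfl | hb
  · have : a = 0 := by simpa using hab
    simp [this]
  have hb' : 0 < |b| := abs_pos.2 hb
  rw [integral_abs_sub_mul_of_ge (a := b) (b := a) hb (by linarith),
    ← sq_abs a, ← sq_abs b]
  have ha' := abs_nonneg a
  set m := |a|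
  set M := |b|
  set l := √(m ^ 2 + M ^ 2)
  have hl : l ^ 2 = m ^ 2 + M ^ 2 := Real.sq_sqrt (by positivity)
  have hl0 : 0 ≤ l := Real.sqrt_nonneg _
  rcases le_total (3 * m) M with h | h
  · rw [integral_abs_sub_mul_of_le (by norm_num) h]
    have h1 : M ≤ l := by nlinarith
    have h2 : l ≤ 2 * M := by nlinarith
    have h3 : m ^ 2 / M ≤ 15 * (l - M) := by
      rw [div_le_iff₀ hb']
      nlinarith
    change 2 * 3 * M + _ ≤ _
    linarith
  · have hm : 0 < m := by linarith
    rw [integral_abs_sub_mul_of_ge (abs_pos.1 hm) h, ← sq_abs b]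
    change 3 ^ 2 * m + M ^ 2 / m + (3 ^ 2 * M + m ^ 2 / M) ≤ 15 * l
    -- Cauchy–Schwarz against `(1, 2) / √5`. The linear bound in `h2` is chosen so that the two
    -- sides agree exactly: `15 * 0.4472 = 9 - 2.292 = (9 + 4.416) / 2`.
    have h1 : 0.4472 * (2 * M + m) ≤ l := by
      apply Real.le_sqrt_of_sq_le
      nlinarith [sq_nonneg (M - 2 * m)]
    have h2 : M ^ 2 / m + m ^ 2 / M ≤ 4.416 * M - 2.292 * m := by
      rw [div_add_div _ _ hm.ne' hb'.ne', div_le_iff₀ (by positivity)]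
      nlinarith [mul_nonneg (mul_nonneg (sub_nonneg.2 h) (sub_nonneg.2 hab)) hm.le,
        mul_nonneg (mul_nonneg (sub_nonneg.2 h) (sub_nonneg.2 hab)) hb'.le, pow_pos hb' 3,
        mul_pos (mul_pos hm hm) hb', mul_pos (mul_pos hb' hb') hm]
    linarith

lemma max_abs_le_length (a b : ℝ) : max |a| |b| ≤ √(a ^ 2 + b ^ 2) :=
  max_le (Real.abs_le_sqrt (by nlinarith [sq_nonneg b])) (Real.abs_le_sqrt (by nlinarith [sq_nonneg a]))

lemma abs_add_abs_sub_eq (a b : ℝ) : |a + b| + |a - b| = 2 * max |a| |b| := by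
  rcases le_total |a| |b| with h | h
  · rw [max_eq_right h]
    rcases abs_cases a with ⟨h1, _⟩ | ⟨h1, _⟩ <;> rcases abs_cases b with ⟨h2, _⟩ | ⟨h2, _⟩ <;>
      rcases abs_cases (a + b) with ⟨h3, _⟩ | ⟨h3, _⟩ <;>
      rcases abs_cases (a - b) with ⟨h4, _⟩ | ⟨h4, _⟩ <;> linarith
  · rw [max_eq_left h]
    rcases abs_cases a with ⟨h1, _⟩ | ⟨h1, _⟩ <;> rcases abs_cases b with ⟨h2, _⟩ | ⟨h2, _⟩ <;>
      rcases abs_cases (a + b) with ⟨h3, _⟩ | ⟨h3, _⟩ <;>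
      rcases abs_cases (a - b) with ⟨h4, _⟩ | ⟨h4, _⟩ <;> linarith

/-- With `d = l - max`, the smaller coordinate is at most `√(2 * l * d)`, made linear by AM–GM. The
weight 225 is nearly optimal for totals `l ≈ 2` and `d ≈ 2e-5`. -/
lemma abs_add_abs_le (a b : ℝ) : |a| + |b| ≤ √(a ^ 2 + b ^ 2) +
    225 * (√(a ^ 2 + b ^ 2) - max |a| |b|) + √(a ^ 2 + b ^ 2) / 450 := by
  wlog hab : |a| ≤ |b| generalizing a b
  · rw [add_comm |a|, add_comm (a ^ 2), max_comm]
    exact this b a (le_of_not_ge hab)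
  have hM := max_abs_le_length a b
  rw [max_eq_right hab] at hM ⊢
  set l := √(a ^ 2 + b ^ 2)
  have hl : l ^ 2 = a ^ 2 + b ^ 2 := Real.sq_sqrt (by positivity)
  rw [← sq_abs a, ← sq_abs b] at hl
  have h0 := abs_nonneg a
  have h1 : |a| ≤ 225 * (l - |b|) + l / 450 := by
    have hl0 : 0 ≤ l := (abs_nonneg b).trans hM
    refine (sq_le_sq₀ h0 (by linarith)).1 ?_
    nlinarith [sq_nonneg (225 * (l - |b|) - l / 450)]
  linarith

lemma length_le_of_tilted {a b : ℝ} (h1 : |b| ≤ 10 * |a|) (h2 : |a| ≤ 10 * |b|) :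
    √(a ^ 2 + b ^ 2) ≤ 202 * (√(a ^ 2 + b ^ 2) - max |a| |b|) := by
  wlog hab : |a| ≤ |b| generalizing a b
  · rw [add_comm (a ^ 2), max_comm]
    exact this h2 h1 (le_of_not_ge hab)
  rw [max_eq_right hab]
  have : 202 / 201 * |b| ≤ √(a ^ 2 + b ^ 2) := by
    apply Real.le_sqrt_of_sq_le
    rw [← sq_abs a, ← sq_abs b]
    have := abs_nonneg b
    nlinarith
  linarith

lemma abs_add_le_sqrt_two (a b : ℝ) : |a| + |b| ≤ 1.4143 * √(a ^ 2 + b ^ 2) := by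
  have h : (|a| + |b|) / 1.4143 ≤ √(a ^ 2 + b ^ 2) := by
    apply Real.le_sqrt_of_sq_le
    rw [← sq_abs a, ← sq_abs b, div_pow, div_le_iff₀ (by norm_num)]
    nlinarith [sq_nonneg (|a| - |b|), sq_nonneg |a|, sq_nonneg |b|]
  rw [div_le_iff₀ (by norm_num)] at h
  linarith

end PlaneVectors

/-! ### Measure estimates for intervals that nearly cover an interval. -/

section Covering

lemma volume_real_uIcc (a b : ℝ) : volume.real (uIcc a b) = |b - a| := by
  simp [uIcc, abs_sub_comm, max_sub_min_eq_abs]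

lemma volume_uIcc_ne_top (a b : ℝ) : volume (uIcc a b) ≠ ⊤ := by
  simp [uIcc]

/-- Lengths of intervals that nearly cover an interval. -/
lemma length_le_add_sum_inter {κ : Type*} [Fintype κ] {I C : Set ℝ} {p q : κ → ℝ} {ε : ℝ}
    (hI : volume I ≠ ⊤) (hC : C ⊆ I)
    (h : volume.real (I \ ⋃ k, uIcc (p k) (q k)) ≤ ε) :
    volume.real C ≤ ε + ∑ k, volume.real (C ∩ uIcc (p k) (q k)) := by
  have h1 : C ⊆ (I \ ⋃ k, uIcc (p k) (q k)) ∪ ⋃ k, C ∩ uIcc (p k) (q k) := by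
    intro t ht
    by_cases hk : ∃ k, t ∈ uIcc (p k) (q k)
    · obtain ⟨k, hk⟩ := hk
      exact Or.inr (mem_iUnion.2 ⟨k, ht, hk⟩)
    · exact Or.inl ⟨hC ht, by simpa using hk⟩
  have hCf : volume C ≠ ⊤ := measure_ne_top_of_subset hC hI
  have h2 : volume ((I \ ⋃ k, uIcc (p k) (q k)) ∪ ⋃ k, C ∩ uIcc (p k) (q k)) ≠ ⊤ :=
    measure_ne_top_of_subset (union_subset sdiff_subset
      (iUnion_subset fun k => inter_subset_left.trans hC)) hI
  calc volume.real C ≤ _ := measureReal_mono h1 h2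
    _ ≤ volume.real (I \ ⋃ k, uIcc (p k) (q k)) + volume.real (⋃ k, C ∩ uIcc (p k) (q k)) :=
        measureReal_union_le _ _
    _ ≤ _ := add_le_add h (measureReal_iUnion_fintype_le _)

/-- The parts inside already account for `r - ε`; what remains of the total length lies outside. -/
lemma sum_outside_le {κ : Type*} [Fintype κ] {r : ℝ} (hr : 0 ≤ r) {p q : κ → ℝ} {ε : ℝ}
    (h : volume.real (Icc (-r / 2) (r / 2) \ ⋃ k, uIcc (p k) (q k)) ≤ ε) :
    ∑ k, volume.real (uIcc (p k) (q k) \ Icc (-r / 2) (r / 2)) ≤ ∑ k, |q k - p k| - r + ε := by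
  have h1 := length_le_add_sum_inter (by simp) Subset.rfl h
  rw [Real.volume_real_Icc_of_le (by linarith)] at h1
  have h2 : ∀ k, |q k - p k| = volume.real (uIcc (p k) (q k) \ Icc (-r / 2) (r / 2)) +
      volume.real (Icc (-r / 2) (r / 2) ∩ uIcc (p k) (q k)) := by
    intro k
    rw [inter_comm, measureReal_sdiff_add_inter measurableSet_Icc (volume_uIcc_ne_top _ _),
      volume_real_uIcc]
  simp_rw [h2, Finset.sum_add_distrib]
  linarith

/-- Shrinking or discarding intervals uncovers at most the length removed, so the overlap of a
reduced family is no larger than the excess of the full one. -/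
lemma overlap_le_excess {κ : Type*} [Fintype κ] [DecidableEq κ] {r : ℝ} (hr : 0 ≤ r)
    {p q c w : κ → ℝ} {ε : ℝ}
    (h : volume.real (Icc (-r / 2) (r / 2) \ ⋃ k, uIcc (p k) (q k)) ≤ ε) (F : Finset κ)
    (hw : ∀ k ∈ F, 0 ≤ w k) (hF : ∀ k ∈ F, Icc (c k) (c k + w k) ⊆ uIcc (p k) (q k)) :
    ∑ k ∈ F, w k - volume.real (⋃ k ∈ F, Icc (c k) (c k + w k)) ≤ ∑ k, |q k - p k| - r + ε := by
  set I := Icc (-r / 2) (r / 2)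
  set U := ⋃ k ∈ F, Icc (c k) (c k + w k)
  have hsub : I ⊆ (I \ ⋃ k, uIcc (p k) (q k)) ∪ (U ∪
      ((⋃ k ∈ F, uIcc (p k) (q k) \ Icc (c k) (c k + w k)) ∪ ⋃ k ∈ Fᶜ, uIcc (p k) (q k))) := by
    intro t ht
    by_cases hk : ∃ k, t ∈ uIcc (p k) (q k)
    · right
      obtain ⟨k, hk⟩ := hk
      by_cases hkF : k ∈ F
      · by_cases hkc : t ∈ Icc (c k) (c k + w k)
        · exact Or.inl (mem_biUnion hkF hkc)
        · exact Or.inr (Or.inl (mem_biUnion (x := k) hkF ⟨hk, hkc⟩))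
      · exact Or.inr (Or.inr (mem_biUnion (x := k) (by simpa using hkF) hk))
    · exact Or.inl ⟨ht, by simpa using hk⟩
  have hfin : ∀ s : Set ℝ, Bornology.IsBounded s → volume s ≠ ⊤ := fun s hs =>
    hs.measure_lt_top.ne
  have hbU : Bornology.IsBounded U := (Bornology.isBounded_biUnion_finset F).2
    fun k _ => Metric.isBounded_Icc _ _
  have hb1 : Bornology.IsBounded (⋃ k ∈ F, uIcc (p k) (q k) \ Icc (c k) (c k + w k)) :=
    (Bornology.isBounded_biUnion_finset F).2 fun k _ => (Metric.isBounded_Icc _ _).subset sdiff_subset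
  have hb2 : Bornology.IsBounded (⋃ k ∈ Fᶜ, uIcc (p k) (q k)) :=
    (Bornology.isBounded_biUnion_finset Fᶜ).2 fun k _ => Metric.isBounded_Icc _ _
  have hb0 : Bornology.IsBounded (I \ ⋃ k, uIcc (p k) (q k)) :=
    (Metric.isBounded_Icc _ _).subset sdiff_subset
  have h1 := measureReal_mono (μ := volume) hsub (hfin _ (hb0.union (hbU.union (hb1.union hb2))))
  have h2 : volume.real (⋃ k ∈ F, uIcc (p k) (q k) \ Icc (c k) (c k + w k)) ≤
      ∑ k ∈ F, (|q k - p k| - w k) := by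
    refine (measureReal_biUnion_finset_le _ _).trans (Finset.sum_le_sum fun k hk => ?_)
    rw [measureReal_sdiff (hF k hk) measurableSet_Icc (volume_uIcc_ne_top _ _), volume_real_uIcc,
      Real.volume_real_Icc_of_le (by linarith [hw k hk])]
    linarith
  have h3 : volume.real (⋃ k ∈ Fᶜ, uIcc (p k) (q k)) ≤ ∑ k ∈ Fᶜ, |q k - p k| := by
    refine (measureReal_biUnion_finset_le _ _).trans (Finset.sum_le_sum fun k hk => ?_)
    rw [volume_real_uIcc]
  have h4 : volume.real I = r := by
    rw [Real.volume_real_Icc_of_le (by linarith)]; ring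
  have h5 := Finset.sum_add_sum_compl F fun k => |q k - p k|
  rw [Finset.sum_sub_distrib] at h2
  have h6 := measureReal_union_le (μ := volume) (I \ ⋃ k, uIcc (p k) (q k)) (U ∪
      ((⋃ k ∈ F, uIcc (p k) (q k) \ Icc (c k) (c k + w k)) ∪ ⋃ k ∈ Fᶜ, uIcc (p k) (q k)))
  have h7 := measureReal_union_le (μ := volume) U
      ((⋃ k ∈ F, uIcc (p k) (q k) \ Icc (c k) (c k + w k)) ∪ ⋃ k ∈ Fᶜ, uIcc (p k) (q k))
  have h8 := measureReal_union_le (μ := volume)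
      (⋃ k ∈ F, uIcc (p k) (q k) \ Icc (c k) (c k + w k)) (⋃ k ∈ Fᶜ, uIcc (p k) (q k))
  linarith

end Covering

/-! ### Finite families of segments: few steep segments on one side, and the exposed corner. -/

section Segments

/-- The segments from `(x₀ k, y₀ k)` to `(x₁ k, y₁ k)` hit all lines `m * x + n * y = t` that meet
the unit square, except for a set of values `t` of measure at most `ε`. -/
def IsNearBarrier {κ : Type*} (x₀ y₀ x₁ y₁ : κ → ℝ) (ε : ℝ) : Prop :=
  ∀ m n : ℝ, |m| ≤ 3 → |n| ≤ 3 → m ≠ 0 ∨ n ≠ 0 →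
    volume.real (Icc (-(|m| + |n|) / 2) ((|m| + |n|) / 2) \
      ⋃ k, uIcc (m * x₀ k + n * y₀ k) (m * x₁ k + n * y₁ k)) ≤ ε

lemma IsNearBarrier.swap {κ : Type*} {x₀ y₀ x₁ y₁ : κ → ℝ} {ε : ℝ}
    (h : IsNearBarrier x₀ y₀ x₁ y₁ ε) : IsNearBarrier y₀ x₀ y₁ x₁ ε := by
  intro m n hm hn hmn
  have := h n m hn hm hmn.symm
  simpa only [add_comm] using this

/-- A nearly vertical segment inside a neighbourhood of the right half (`σ = 1`) or of the left half
(`σ = -1`) of the unit square. -/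
def IsSteep (x₀ y₀ x₁ y₁ σ : ℝ) : Prop :=
  10 * |x₁ - x₀| ≤ |y₁ - y₀| ∧ |y₀| ≤ 0.51 ∧ |y₁| ≤ 0.51 ∧
    (0.2 ≤ σ * x₀ ∧ σ * x₀ ≤ 1.62) ∧ 0.2 ≤ σ * x₁ ∧ σ * x₁ ≤ 1.62

variable {κ : Type*} [Fintype κ] {x₀ y₀ x₁ y₁ : κ → ℝ} {ε : ℝ}

open Classical in
/-- The total height of the steep segments on one side. -/
noncomputable def steepMass (x₀ y₀ x₁ y₁ : κ → ℝ) (σ : ℝ) : ℝ :=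
  ∑ k, if IsSteep (x₀ k) (y₀ k) (x₁ k) (y₁ k) σ then |y₁ k - y₀ k| else 0

lemma IsNearBarrier.sum_outside_le (h : IsNearBarrier x₀ y₀ x₁ y₁ ε) {m n : ℝ} (hm : |m| ≤ 3)
    (hn : |n| ≤ 3) (hmn : m ≠ 0 ∨ n ≠ 0) :
    ∑ k, volume.real (uIcc (m * x₀ k + n * y₀ k) (m * x₁ k + n * y₁ k) \
      Icc (-(|m| + |n|) / 2) ((|m| + |n|) / 2)) ≤
      ∑ k, |m * (x₁ k - x₀ k) + n * (y₁ k - y₀ k)| - (|m| + |n|) + ε := by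
  refine (_root_.sum_outside_le (by positivity) (h m n hm hn hmn)).trans_eq ?_
  congr! 4
  ring

lemma IsNearBarrier.le_sum_abs (h : IsNearBarrier x₀ y₀ x₁ y₁ ε) {m n : ℝ} (hm : |m| ≤ 3)
    (hn : |n| ≤ 3) (hmn : m ≠ 0 ∨ n ≠ 0) :
    |m| + |n| - ε ≤ ∑ k, |m * (x₁ k - x₀ k) + n * (y₁ k - y₀ k)| := by
  have h1 := h.sum_outside_le hm hn hmn
  have h2 : 0 ≤ ∑ k, volume.real (uIcc (m * x₀ k + n * y₀ k) (m * x₁ k + n * y₁ k) \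
      Icc (-(|m| + |n|) / 2) ((|m| + |n|) / 2)) := Finset.sum_nonneg fun _ _ => measureReal_nonneg
  linarith

/-- The total overlap of the projections along lines of slope `s`. -/
def excess (x₀ y₀ x₁ y₁ : κ → ℝ) (ε s : ℝ) : ℝ :=
  ∑ k, |(y₁ k - y₀ k) - s * (x₁ k - x₀ k)| - (1 + |s|) + ε

lemma continuous_excess : Continuous (excess x₀ y₀ x₁ y₁ ε) := by
  unfold excess
  fun_prop

lemma excess_le_add (s t : ℝ) : excess x₀ y₀ x₁ y₁ ε s ≤ excess x₀ y₀ x₁ y₁ ε t +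
    (∑ k, |x₁ k - x₀ k| + 1) * |s - t| := by
  have h1 : ∑ k, |(y₁ k - y₀ k) - s * (x₁ k - x₀ k)| ≤
      ∑ k, |(y₁ k - y₀ k) - t * (x₁ k - x₀ k)| + (∑ k, |x₁ k - x₀ k|) * |s - t| := by
    rw [Finset.sum_mul, ← Finset.sum_add_distrib]
    refine Finset.sum_le_sum fun k _ => ?_
    rw [← abs_mul, show (y₁ k - y₀ k) - s * (x₁ k - x₀ k) = ((y₁ k - y₀ k) - t * (x₁ k - x₀ k)) -
      (x₁ k - x₀ k) * (s - t) by ring]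
    exact abs_sub _ _
  have h2 : |t| ≤ |s| + |s - t| := by
    have := abs_sub s (s - t)
    rwa [sub_sub_cancel] at this
  unfold excess
  linarith

lemma IsNearBarrier.excess_nonneg (h : IsNearBarrier x₀ y₀ x₁ y₁ ε) {s : ℝ} (hs : |s| ≤ 3) :
    0 ≤ excess x₀ y₀ x₁ y₁ ε s := by
  have := h.le_sum_abs (m := -s) (n := 1) (by simpa using hs) (by norm_num) (by simp)
  have e : ∑ k, |-s * (x₁ k - x₀ k) + 1 * (y₁ k - y₀ k)| =
    ∑ k, |(y₁ k - y₀ k) - s * (x₁ k - x₀ k)| := by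
    congr! 2; ring
  rw [e, abs_neg, abs_one] at this
  unfold excess
  linarith

/-- The slopes with exchanged axes contribute a nonnegative excess, so the bound for both families
together also bounds this one. -/
lemma integral_excess_le (h : IsNearBarrier x₀ y₀ x₁ y₁ ε) :
    ∫ s in (-3 : ℝ)..3, excess x₀ y₀ x₁ y₁ ε s ≤
      15 * ∑ k, √((x₁ k - x₀ k) ^ 2 + (y₁ k - y₀ k) ^ 2) - 30 + 12 * ε := by
  have hint : ∀ a b : κ → ℝ, ∫ s in (-3 : ℝ)..3, (∑ k, |b k - s * a k| - (1 + |s|) + ε) =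
      ∑ k, (∫ s in (-3 : ℝ)..3, |b k - s * a k|) - 15 + 6 * ε := by
    intro a b
    have habs : ∫ s in (-3 : ℝ)..3, |s| = 9 := by
      have := integral_abs_sub_mul_of_ge (a := 1) (b := 0) (S := 3) one_ne_zero (by norm_num)
      norm_num at this
      exact this
    rw [intervalIntegral.integral_add (Continuous.intervalIntegrable (by fun_prop) _ _) (by simp),
      intervalIntegral.integral_sub (Continuous.intervalIntegrable (by fun_prop) _ _)
        (Continuous.intervalIntegrable (by fun_prop) _ _),
      intervalIntegral.integral_add (by simp) (Continuous.intervalIntegrable (by fun_prop) _ _),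
      intervalIntegral.integral_finsetSum
        fun k _ => Continuous.intervalIntegrable (by fun_prop) _ _, habs]
    simp
    ring
  have h0 : 0 ≤ ∫ s in (-3 : ℝ)..3, excess y₀ x₀ y₁ x₁ ε s :=
    intervalIntegral.integral_nonneg (by norm_num) fun s hs =>
      h.swap.excess_nonneg (abs_le.2 ⟨hs.1, hs.2⟩)
  have h1 := hint (fun k => x₁ k - x₀ k) (fun k => y₁ k - y₀ k)
  have h2 := hint (fun k => y₁ k - y₀ k) (fun k => x₁ k - x₀ k)
  have h3 := Finset.sum_le_sum fun k (_ : k ∈ Finset.univ) =>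
    integral_abs_add_integral_abs_le (x₁ k - x₀ k) (y₁ k - y₀ k)
  rw [Finset.sum_add_distrib, ← Finset.mul_sum] at h3
  unfold excess at h0 ⊢
  linarith

/-- The steep segments cannot be plentiful on both sides. -/
lemma IsNearBarrier.exists_steepMass_le (h : IsNearBarrier x₀ y₀ x₁ y₁ ε)
    (hε : ε ≤ 1e-7) (hlen : ∑ k, √((x₁ k - x₀ k) ^ 2 + (y₁ k - y₀ k) ^ 2) ≤ 2.00002) :
    ∃ σ : ℝ, (σ = 1 ∨ σ = -1) ∧ steepMass x₀ y₀ x₁ y₁ σ ≤ 0.0643 := by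
  classical
  by_contra! hcon
  have hp := hcon 1 (Or.inl rfl)
  have hn := hcon (-1) (Or.inr rfl)
  set P : Finset κ := Finset.univ.filter fun k => IsSteep (x₀ k) (y₀ k) (x₁ k) (y₁ k) 1 with hP
  set N : Finset κ := Finset.univ.filter fun k => IsSteep (x₀ k) (y₀ k) (x₁ k) (y₁ k) (-1) with hN
  have hPs : steepMass x₀ y₀ x₁ y₁ 1 = ∑ k ∈ P, |y₁ k - y₀ k| := by
    rw [hP, Finset.sum_filter]; rfl
  have hNs : steepMass x₀ y₀ x₁ y₁ (-1) = ∑ k ∈ N, |y₁ k - y₀ k| := by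
    rw [hN, Finset.sum_filter]; rfl
  set vP := steepMass x₀ y₀ x₁ y₁ 1
  set vN := steepMass x₀ y₀ x₁ y₁ (-1)
  -- bottom endpoints, and heights scaled to a total of `0.045` on either side
  set x : κ → ℝ := fun k => if y₀ k ≤ y₁ k then x₀ k else x₁ k with hx
  set y : κ → ℝ := fun k => if y₀ k ≤ y₁ k then y₀ k else y₁ k with hy
  set w : κ → ℝ := fun k => 0.045 / (if 0 < x₀ k then vP else vN) * |y₁ k - y₀ k| with hw
  have hw0 : ∀ k, 0 ≤ w k := fun k => by
    simp only [hw]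
    have : 0 ≤ if 0 < x₀ k then vP else vN := by split_ifs <;> linarith
    positivity
  -- For `|s| ≤ 3` and `10 * |dx| ≤ |dy|`, the shadow still reaches `0.7 * |dy|` above its bottom
  -- endpoint; and `0.045 ≤ 0.7 * 0.0643`.
  have hw1 : ∀ k, w k ≤ 0.7 * |y₁ k - y₀ k| := fun k => by
    simp only [hw]
    refine mul_le_mul_of_nonneg_right ?_ (abs_nonneg _)
    have : 0.0643 < if 0 < x₀ k then vP else vN := by split_ifs <;> assumption
    rw [div_le_iff₀ (by linarith)]
    linarith
  have hPpos : ∀ k ∈ P, 0 < x₀ k := fun k hk => by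
    have := (Finset.mem_filter.1 hk).2.2.2.2.1.1; linarith
  have hNneg : ∀ k ∈ N, ¬ 0 < x₀ k := fun k hk => by
    have := (Finset.mem_filter.1 hk).2.2.2.2.1.1; linarith
  have hPw : ∑ k ∈ P, w k = 0.045 := by
    rw [Finset.sum_congr rfl fun k hk => show w k = 0.045 / vP * |y₁ k - y₀ k| by
      simp only [hw, if_pos (hPpos k hk)], ← Finset.mul_sum, ← hPs]
    field_simp
  have hNw : ∑ k ∈ N, w k = 0.045 := by
    rw [Finset.sum_congr rfl fun k hk => show w k = 0.045 / vN * |y₁ k - y₀ k| by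
      simp only [hw, if_neg (hNneg k hk)], ← Finset.mul_sum, ← hNs]
    field_simp
  have hPb : ∀ k ∈ P, |y k| ≤ 0.51 ∧ 0.2 ≤ x k ∧ x k ≤ 1.62 := by
    intro k hk
    obtain ⟨-, h1, h2, h3, h4⟩ := (Finset.mem_filter.1 hk).2
    simp only [hx, hy]
    split_ifs
    · exact ⟨h1, by linarith, by linarith⟩
    · exact ⟨h2, by linarith, by linarith⟩
  have hNb : ∀ k ∈ N, |y k| ≤ 0.51 ∧ 0.2 ≤ -x k ∧ -x k ≤ 1.62 := by
    intro k hk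
    obtain ⟨-, h1, h2, h3, h4⟩ := (Finset.mem_filter.1 hk).2
    simp only [hx, hy]
    split_ifs
    · exact ⟨h1, by linarith, by linarith⟩
    · exact ⟨h2, by linarith, by linarith⟩
  have hwN : ∀ i ∈ N, w i ≤ 0.045 := fun i hi => hNw ▸ Finset.single_le_sum (fun k _ => hw0 k) hi
  have hwP : ∀ i ∈ P, w i ≤ 0.045 := fun i hi => hPw ▸ Finset.single_le_sum (fun k _ => hw0 k) hi
  have hdisj : Disjoint N P := Finset.disjoint_left.2 fun k hk hk' => hNneg k hk (hPpos k hk')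
  -- The spread is 3.24 = 2 · 1.62. At slopes ±3 the bottom endpoints are separated by at least 2 ·
  -- 3 · 0.2 − 2 · 0.51 = 0.18, room for both masses.
  have key := mul_mass_le_integral_overlap (A := N) (B := P) (x := x) (y := y) (w := w) (S := 3)
    (D := 3.24) (W := excess x₀ y₀ x₁ y₁ ε) (by norm_num) (by norm_num) (fun i _ => hw0 i)
    (fun i _ => hw0 i)
    (fun i hi j hj => by linarith [(hNb i hi).2.2, (hPb j hj).2.2])
    (fun i hi j hj => by
      linarith [(abs_le.1 (hNb i hi).1).2, (hNb i hi).2.1, (hPb j hj).2.1,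
        (abs_le.1 (hPb j hj).1).1, hwN i hi])
    (fun i hi j hj => by
      linarith [(abs_le.1 (hNb i hi).1).1, (hNb i hi).2.1, (hPb j hj).2.1,
        (abs_le.1 (hPb j hj).1).2, hwP j hj])
    continuous_excess excess_le_add (fun s hs hs' => by
      have hs3 : |s| ≤ 3 := abs_le.2 ⟨hs, hs'⟩
      have h1 := overlap_le_excess (c := fun k => y k - s * x k) (w := w) (by positivity)
        (h (-s) 1 (by simpa using hs3) (by norm_num) (by simp)) (N ∪ P) (fun k _ => hw0 k) (by
          intro k hk
          have hst : 10 * |x₁ k - x₀ k| ≤ |y₁ k - y₀ k| := by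
            rcases Finset.mem_union.1 hk with hk | hk <;> exact (Finset.mem_filter.1 hk).2.1
          have hsx : |s * (x₁ k - x₀ k)| ≤ 0.3 * |y₁ k - y₀ k| := by
            rw [abs_mul]
            have := mul_le_mul_of_nonneg_right hs3 (abs_nonneg (x₁ k - x₀ k))
            linarith
          have hwk := hw1 k
          have hsx' := abs_le.1 hsx
          intro t ht
          simp only [hx, hy, mem_Icc] at ht
          rw [mem_uIcc]
          split_ifs at ht with hy01
          · rw [abs_of_nonneg (by linarith : 0 ≤ y₁ k - y₀ k)] at hwk hsx'
            left
            constructor <;> linarith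
          · rw [abs_of_nonpos (by linarith : y₁ k - y₀ k ≤ 0)] at hwk hsx'
            right
            constructor <;> linarith)
      rw [Finset.sum_union hdisj] at h1
      have e : ∑ k, |-s * x₁ k + 1 * y₁ k - (-s * x₀ k + 1 * y₀ k)| =
          ∑ k, |(y₁ k - y₀ k) - s * (x₁ k - x₀ k)| :=
        Finset.sum_congr rfl fun k _ => by congr 1; ring
      rw [e, abs_neg, abs_one] at h1
      unfold excess
      linarith)
  rw [hPw, hNw] at key
  -- The product 0.045² = 0.002025 exceeds 3.24 · (15 · 0.00002 + 12 · 10⁻⁷) < 0.001.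
  have := integral_excess_le h
  linarith

/-- The part of a nearly vertical segment that meets the lines cutting off a corner of the unit
square. -/
lemma corner_contribution_le {x₀ y₀ x₁ y₁ σ τ : ℝ} [Decidable (IsSteep x₀ y₀ x₁ y₁ σ)]
    (hσ : σ = 1 ∨ σ = -1) (hτ : τ = 1 ∨ τ = -1) (hst : 10 * |x₁ - x₀| ≤ |y₁ - y₀|)
    (hy : |y₁ - y₀| ≤ 1.01)
    (hout : volume.real (uIcc y₀ y₁ \ Icc (-1 / 2) (1 / 2)) ≤ 0.0091) :
    volume.real (Icc 0.82 1 ∩ uIcc (σ * x₀ + τ * y₀) (σ * x₁ + τ * y₁)) ≤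
      1.1 * volume.real (uIcc y₀ y₁ \ Icc (-1 / 2) (1 / 2)) +
        1.1 * if IsSteep x₀ y₀ x₁ y₁ σ then |y₁ - y₀| else 0 := by
  have habsσ : |σ| = 1 := by rcases hσ with rfl | rfl <;> simp
  have habsτ : |τ| = 1 := by rcases hτ with rfl | rfl <;> simp
  have hle : volume.real (Icc 0.82 1 ∩ uIcc (σ * x₀ + τ * y₀) (σ * x₁ + τ * y₁)) ≤
      1.1 * |y₁ - y₀| := by
    refine (measureReal_mono inter_subset_right (volume_uIcc_ne_top _ _)).trans ?_
    rw [volume_real_uIcc, show σ * x₁ + τ * y₁ - (σ * x₀ + τ * y₀) =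
      σ * (x₁ - x₀) + τ * (y₁ - y₀) by ring]
    refine (abs_add_le _ _).trans ?_
    rw [abs_mul, abs_mul, habsσ, habsτ]
    linarith
  have h0 : 0 ≤ volume.real (uIcc y₀ y₁ \ Icc (-1 / 2) (1 / 2)) := measureReal_nonneg
  by_cases htouch : (uIcc y₀ y₁ ∩ Icc (-1 / 2) (1 / 2)).Nonempty
  swap
  -- A segment missing the strip `|y| ≤ 1/2` counts entirely as outside.
  · rw [sdiff_eq_self_iff_disjoint.2 (disjoint_iff_inter_eq_empty.2
      (by rwa [inter_comm, ← not_nonempty_iff_eq_empty])), volume_real_uIcc]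
    have : 0 ≤ if IsSteep x₀ y₀ x₁ y₁ σ then |y₁ - y₀| else 0 := by split_ifs <;> positivity
    linarith
  by_cases hcut : (Icc (0.82 : ℝ) 1 ∩ uIcc (σ * x₀ + τ * y₀) (σ * x₁ + τ * y₁)).Nonempty
  swap
  · rw [not_nonempty_iff_eq_empty.1 hcut]
    have : 0 ≤ if IsSteep x₀ y₀ x₁ y₁ σ then |y₁ - y₀| else 0 := by split_ifs <;> positivity
    simp only [measureReal_empty]
    linarith
  obtain ⟨t, ht, ht'⟩ := htouch
  have hsub : ∀ a b : ℝ, Ioc a b ⊆ uIcc y₀ y₁ \ Icc (-1 / 2) (1 / 2) → b - a ≤ 0.0091 := by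
    intro a b hab
    rcases le_total b a with h | h
    · linarith
    · have := measureReal_mono (μ := volume) hab
        (measure_ne_top_of_subset sdiff_subset (volume_uIcc_ne_top y₀ y₁))
      rw [Real.volume_real_Ioc_of_le h] at this
      linarith
  have hsub' : ∀ a b : ℝ, Ico a b ⊆ uIcc y₀ y₁ \ Icc (-1 / 2) (1 / 2) → b - a ≤ 0.0091 := by
    intro a b hab
    rcases le_total b a with h | h
    · linarith
    · have := measureReal_mono (μ := volume) hab
        (measure_ne_top_of_subset sdiff_subset (volume_uIcc_ne_top y₀ y₁))
      rw [Real.volume_real_Ico_of_le h] at this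
      linarith
  -- The segment touches the strip, so reaching height `z` beyond it leaves an interval of length
  -- `|z| - 1/2` outside.
  have hbd : ∀ z ∈ uIcc y₀ y₁, |z| ≤ 0.5091 := by
    intro z hz
    have hord := ordConnected_uIcc (a := y₀) (b := y₁)
    rw [abs_le]
    constructor
    · have := hsub' z (-1 / 2) fun u hu =>
        ⟨hord.out hz ht ⟨hu.1, by linarith [hu.2, ht'.1]⟩, fun h => by linarith [h.1, hu.2]⟩
      linarith
    · have := hsub (1 / 2) z fun u hu =>
        ⟨hord.out ht hz ⟨by linarith [hu.1, ht'.2], hu.2⟩, fun h => by linarith [h.2, hu.1]⟩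
      linarith
  have hy0 := hbd y₀ left_mem_uIcc
  have hy1 := hbd y₁ right_mem_uIcc
  have hτ0 : |τ * y₀| ≤ 0.5091 := by rwa [abs_mul, habsτ, one_mul]
  have hτ1 : |τ * y₁| ≤ 0.5091 := by rwa [abs_mul, habsτ, one_mul]
  have hσx : |σ * x₁ - σ * x₀| ≤ 0.101 := by
    rw [← mul_sub, abs_mul, habsσ, one_mul]; linarith
  obtain ⟨u, hu, hu'⟩ := hcut
  -- The constants in `IsSteep` come from here: 0.82 − 0.5091 − 0.101 ≥ 0.2 and 1 + 0.5091 + 0.101 ≤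
  -- 1.62.
  have hS : IsSteep x₀ y₀ x₁ y₁ σ := by
    rw [abs_le] at hτ0 hτ1 hσx
    rw [mem_uIcc] at hu'
    refine ⟨hst, hy0.trans (by norm_num), hy1.trans (by norm_num), ?_⟩
    rcases hu' with hu' | hu' <;> refine ⟨⟨?_, ?_⟩, ?_, ?_⟩ <;> linarith [hu.1, hu.2]
  rw [if_pos hS]
  linarith

/-- No family of segments of total length `2.00002` is nearly a barrier. -/
theorem IsNearBarrier.length_gt (h : IsNearBarrier x₀ y₀ x₁ y₁ 1e-7) :
    2.00002 < ∑ k, √((x₁ k - x₀ k) ^ 2 + (y₁ k - y₀ k) ^ 2) := by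
  classical
  by_contra! hlen
  have hlen' : ∑ k, √((y₁ k - y₀ k) ^ 2 + (x₁ k - x₀ k) ^ 2) ≤ 2.00002 := by
    simpa only [add_comm] using hlen
  set l : κ → ℝ := fun k => √((x₁ k - x₀ k) ^ 2 + (y₁ k - y₀ k) ^ 2) with hl
  set M : κ → ℝ := fun k => max |x₁ k - x₀ k| |y₁ k - y₀ k| with hM
  have hMl : ∀ k, M k ≤ l k := fun k => max_abs_le_length _ _
  -- The two diagonal directions together see each segment with twice its maximum norm.
  have hdiag : 2 - 1e-7 ≤ ∑ k, M k := by
    have h1 := h.le_sum_abs (m := 1) (n := 1) (by norm_num) (by norm_num) (by norm_num)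
    have h2 := h.le_sum_abs (m := 1) (n := -1) (by norm_num) (by norm_num) (by norm_num)
    have h3 : ∑ k, |1 * (x₁ k - x₀ k) + 1 * (y₁ k - y₀ k)| +
        ∑ k, |1 * (x₁ k - x₀ k) + -1 * (y₁ k - y₀ k)| = 2 * ∑ k, M k := by
      rw [← Finset.sum_add_distrib, Finset.mul_sum]
      refine Finset.sum_congr rfl fun k _ => ?_
      rw [hM, ← abs_add_abs_sub_eq]
      ring_nf
    norm_num at h1 h2 h3 ⊢
    linarith
  have hdev : ∑ k, (l k - M k) ≤ 2.01e-5 := by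
    rw [Finset.sum_sub_distrib]
    linarith
  have hsum : ∑ k, |x₁ k - x₀ k| + ∑ k, |y₁ k - y₀ k| ≤ 2.0090 - 2e-7 := by
    have h0 : ∀ k, |x₁ k - x₀ k| + |y₁ k - y₀ k| ≤ l k + 225 * (l k - M k) + l k / 450 :=
      fun k => abs_add_abs_le _ _
    have h1 := Finset.sum_le_sum fun k (_ : k ∈ Finset.univ) => h0 k
    rw [Finset.sum_add_distrib, Finset.sum_add_distrib, Finset.sum_add_distrib, ← Finset.mul_sum,
      ← Finset.sum_div] at h1
    linarith
  have hX : 1 - 1e-7 ≤ ∑ k, |x₁ k - x₀ k| := by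
    have := h.le_sum_abs (m := 1) (n := 0) (by norm_num) (by norm_num) (by norm_num)
    simpa using this
  have hY : 1 - 1e-7 ≤ ∑ k, |y₁ k - y₀ k| := by
    have := h.le_sum_abs (m := 0) (n := 1) (by norm_num) (by norm_num) (by norm_num)
    simpa using this
  have hXle : ∀ k, |x₁ k - x₀ k| ≤ 1.01 := fun k => by
    have := Finset.single_le_sum (f := fun k => |x₁ k - x₀ k|) (fun i _ => abs_nonneg _)
      (Finset.mem_univ k)
    linarith
  have hYle : ∀ k, |y₁ k - y₀ k| ≤ 1.01 := fun k => by
    have := Finset.single_le_sum (f := fun k => |y₁ k - y₀ k|) (fun i _ => abs_nonneg _)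
      (Finset.mem_univ k)
    linarith
  set oX : κ → ℝ := fun k => volume.real (uIcc (x₀ k) (x₁ k) \ Icc (-1 / 2) (1 / 2)) with hoX
  set oY : κ → ℝ := fun k => volume.real (uIcc (y₀ k) (y₁ k) \ Icc (-1 / 2) (1 / 2)) with hoY
  have hoX0 : ∀ k, 0 ≤ oX k := fun k => measureReal_nonneg
  have hoY0 : ∀ k, 0 ≤ oY k := fun k => measureReal_nonneg
  have hoXs : ∑ k, oX k ≤ 0.0091 := by
    have h1 := h.sum_outside_le (m := 1) (n := 0) (by norm_num) (by norm_num) (by norm_num)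
    simp only [one_mul, zero_mul, add_zero, abs_one, abs_zero] at h1
    have h2 : ∑ k, oX k ≤ ∑ k, |x₁ k - x₀ k| - 1 + 1e-7 := h1
    linarith
  have hoYs : ∑ k, oY k ≤ 0.0091 := by
    have h1 := h.sum_outside_le (m := 0) (n := 1) (by norm_num) (by norm_num) (by norm_num)
    simp only [one_mul, zero_mul, zero_add, abs_one, abs_zero] at h1
    have h2 : ∑ k, oY k ≤ ∑ k, |y₁ k - y₀ k| - 1 + 1e-7 := h1
    linarith
  obtain ⟨σ, hσ, hV⟩ := h.exists_steepMass_le le_rfl hlen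
  obtain ⟨τ, hτ, hH⟩ := h.swap.exists_steepMass_le le_rfl hlen'
  unfold steepMass at hV hH
  have habsσ : |σ| = 1 := by rcases hσ with rfl | rfl <;> simp
  have habsτ : |τ| = 1 := by rcases hτ with rfl | rfl <;> simp
  have hcorner := length_le_add_sum_inter (C := Icc 0.82 1) (by simp)
    (Icc_subset_Icc (by rw [habsσ, habsτ]; norm_num) (by rw [habsσ, habsτ]; norm_num))
    (h σ τ (by rw [habsσ]; norm_num) (by rw [habsτ]; norm_num)
      (Or.inl (by rcases hσ with rfl | rfl <;> norm_num)))
  have hcontr : ∀ k, volume.real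
      (Icc 0.82 1 ∩ uIcc (σ * x₀ k + τ * y₀ k) (σ * x₁ k + τ * y₁ k)) ≤
      1.1 * oY k + 1.1 * (if IsSteep (x₀ k) (y₀ k) (x₁ k) (y₁ k) σ then |y₁ k - y₀ k| else 0) +
      (1.1 * oX k + 1.1 * (if IsSteep (y₀ k) (x₀ k) (y₁ k) (x₁ k) τ then |x₁ k - x₀ k| else 0)) +
      285.7 * (l k - M k) := by
    intro k
    have p1 : 0 ≤ if IsSteep (x₀ k) (y₀ k) (x₁ k) (y₁ k) σ then |y₁ k - y₀ k| else 0 := by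
      split_ifs <;> positivity
    have p2 : 0 ≤ if IsSteep (y₀ k) (x₀ k) (y₁ k) (x₁ k) τ then |x₁ k - x₀ k| else 0 := by
      split_ifs <;> positivity
    have p3 := hMl k
    have p4 := hoX0 k
    have p5 := hoY0 k
    -- Steep and flat segments are handled by `corner_contribution_le`. A tilted one pays through
    -- its deviation, with 202 · 1.4143 ≤ 285.7.
    by_cases hv : 10 * |x₁ k - x₀ k| ≤ |y₁ k - y₀ k|
    · have : _ ≤ 1.1 * oY k + _ := corner_contribution_le (x₀ := x₀ k) (y₀ := y₀ k) (x₁ := x₁ k) (y₁ := y₁ k) hσ hτ hv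
        (hYle k) ((Finset.single_le_sum (fun i _ => hoY0 i) (Finset.mem_univ k)).trans hoYs)
      refine this.trans ?_
      linarith
    by_cases hh : 10 * |y₁ k - y₀ k| ≤ |x₁ k - x₀ k|
    · have : _ ≤ 1.1 * oX k + _ := corner_contribution_le (x₀ := y₀ k) (y₀ := x₀ k) (x₁ := y₁ k) (y₁ := x₁ k) hτ hσ hh
        (hXle k) ((Finset.single_le_sum (fun i _ => hoX0 i) (Finset.mem_univ k)).trans hoXs)
      rw [add_comm (τ * _), add_comm (τ * _)] at this
      refine this.trans ?_
      linarith
    · have b1 := length_le_of_tilted (le_of_not_ge hv) (le_of_not_ge hh)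
      have b2 := abs_add_le_sqrt_two (x₁ k - x₀ k) (y₁ k - y₀ k)
      have b3 : volume.real (Icc 0.82 1 ∩ uIcc (σ * x₀ k + τ * y₀ k) (σ * x₁ k + τ * y₁ k)) ≤
          |x₁ k - x₀ k| + |y₁ k - y₀ k| := by
        refine (measureReal_mono inter_subset_right (volume_uIcc_ne_top _ _)).trans ?_
        rw [volume_real_uIcc, show σ * x₁ k + τ * y₁ k - (σ * x₀ k + τ * y₀ k) =
          σ * (x₁ k - x₀ k) + τ * (y₁ k - y₀ k) by ring]
        refine (abs_add_le _ _).trans_eq ?_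
        rw [abs_mul, abs_mul, habsσ, habsτ, one_mul, one_mul]
      simp only [hl, hM] at p3 ⊢
      linarith
  -- Corner lines fill a length 0.18, but 2.2 · (0.0091 + 0.0643) + 285.7 · 2.01e-5 + 10⁻⁷ < 0.168.
  have hfin := Finset.sum_le_sum fun k (_ : k ∈ Finset.univ) => hcontr k
  simp only [Finset.sum_add_distrib, ← Finset.mul_sum] at hfin
  rw [Real.volume_real_Icc_of_le (by norm_num)] at hcorner
  linarith

end Segments

/-! ### From rectifiable barriers to finitely many segments. -/

section Reduction

lemma Plane.dist_eq_sqrt (p q : Plane) : dist p q = √((q 0 - p 0) ^ 2 + (q 1 - p 1) ^ 2) := by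
  rw [dist_comm, EuclideanSpace.dist_eq, Fin.sum_univ_two, Real.dist_eq, Real.dist_eq, sq_abs, sq_abs]

/-- The squared distance from a point to a mirror image of another one. -/
lemma four_mul_sq_le {u v u' v' a b e m n : ℝ} (ha : 0 ≤ a) (hb : 0 ≤ b) (ha2 : a ^ 2 = u ^ 2 + v ^ 2)
    (hb2 : b ^ 2 = u' ^ 2 + v' ^ 2) (he : 0 ≤ e) (h : e ≤ m * u + n * v) (h' : e ≤ m * u' + n * v') :
    4 * e ^ 2 ≤ (m ^ 2 + n ^ 2) * ((a + b) ^ 2 - ((u - u') ^ 2 + (v - v') ^ 2)) := by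
  have hK : 0 ≤ (m ^ 2 + n ^ 2) * (a * b) := by positivity
  -- Cauchy–Schwarz, in coordinates along and across `(m, n)`, after reflecting one vector; `e2` is
  -- the Lagrange identity.
  have hcs : (m * u + n * v) * (m * u' + n * v') - (n * u - m * v) * (n * u' - m * v') ≤
      (m ^ 2 + n ^ 2) * (a * b) := by
    refine le_of_abs_le (abs_le_of_sq_le_sq ?_ hK)
    have e1 : ((m ^ 2 + n ^ 2) * (a * b)) ^ 2 =
        (m ^ 2 + n ^ 2) ^ 2 * ((u ^ 2 + v ^ 2) * (u' ^ 2 + v' ^ 2)) := by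
      rw [← ha2, ← hb2]; ring
    have e2 : (m ^ 2 + n ^ 2) ^ 2 * ((u ^ 2 + v ^ 2) * (u' ^ 2 + v' ^ 2)) =
        ((m * u + n * v) * (m * u' + n * v') - (n * u - m * v) * (n * u' - m * v')) ^ 2 +
        ((m * u + n * v) * (n * u' - m * v') + (n * u - m * v) * (m * u' + n * v')) ^ 2 := by ring
    rw [e1, e2]
    exact le_add_of_nonneg_right (sq_nonneg _)
  have h1 : e * e ≤ (m * u + n * v) * (m * u' + n * v') := mul_le_mul h h' he (he.trans h)
  have e3 : (m ^ 2 + n ^ 2) * ((a + b) ^ 2 - ((u - u') ^ 2 + (v - v') ^ 2)) =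
      2 * ((m ^ 2 + n ^ 2) * (a * b)) + 2 * ((m * u + n * v) * (m * u' + n * v') +
        (n * u - m * v) * (n * u' - m * v')) := by
    rw [add_sq, ha2, hb2]; ring
  rw [e3]
  linarith

/-- A line through a point `z` on an arc of length at most `l` from `p` to `q` comes close to the
chord. -/
lemma apply_le_max_add {p q z : Plane} {l A m n : ℝ} (hl : dist z p + dist z q ≤ l) (hA : 0 < A)
    (hm : |m| ≤ 3) (hn : |n| ≤ 3) :
    m * z 0 + n * z 1 ≤ max (m * p 0 + n * p 1) (m * q 0 + n * q 1) +
      3 * (A * (l - dist p q) + l / (2 * A)) := by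
  have htri : dist p q ≤ l := (dist_triangle_left p q z).trans hl
  have hd0 : 0 ≤ dist p q := dist_nonneg
  have hl0 : 0 ≤ l := hd0.trans htri
  set e := m * z 0 + n * z 1 - max (m * p 0 + n * p 1) (m * q 0 + n * q 1) with he
  have hE : 0 ≤ A * (l - dist p q) + l / (2 * A) :=
    add_nonneg (mul_nonneg hA.le (sub_nonneg.2 htri)) (by positivity)
  rcases le_total e 0 with h | h
  · linarith
  suffices e ≤ 3 * (A * (l - dist p q) + l / (2 * A)) by linarith
  have hpe : e ≤ m * (z 0 - p 0) + n * (z 1 - p 1) := by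
    have := le_max_left (m * p 0 + n * p 1) (m * q 0 + n * q 1)
    linarith
  have hqe : e ≤ m * (z 0 - q 0) + n * (z 1 - q 1) := by
    have := le_max_right (m * p 0 + n * p 1) (m * q 0 + n * q 1)
    linarith
  have hds : dist p q ^ 2 = (q 0 - p 0) ^ 2 + (q 1 - p 1) ^ 2 := by
    rw [Plane.dist_eq_sqrt, Real.sq_sqrt (by positivity)]
  have hps : dist z p ^ 2 = (z 0 - p 0) ^ 2 + (z 1 - p 1) ^ 2 := by
    rw [dist_comm, Plane.dist_eq_sqrt, Real.sq_sqrt (by positivity)]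
  have hqs : dist z q ^ 2 = (z 0 - q 0) ^ 2 + (z 1 - q 1) ^ 2 := by
    rw [dist_comm, Plane.dist_eq_sqrt, Real.sq_sqrt (by positivity)]
  have hp0 : 0 ≤ dist z p := dist_nonneg
  have hq0 : 0 ≤ dist z q := dist_nonneg
  have hsq : (dist z p + dist z q) ^ 2 ≤ l ^ 2 := by gcongr
  have h4 : 4 * e ^ 2 ≤ 18 * (l ^ 2 - dist p q ^ 2) := by
    have h1 := four_mul_sq_le hp0 hq0 hps hqs h hpe hqe
    rw [show z 0 - p 0 - (z 0 - q 0) = q 0 - p 0 by ring,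
      show z 1 - p 1 - (z 1 - q 1) = q 1 - p 1 by ring, ← hds] at h1
    have hm2 : m ^ 2 ≤ 3 ^ 2 := sq_le_sq' (abs_le.1 hm).1 (abs_le.1 hm).2
    have hn2 : n ^ 2 ≤ 3 ^ 2 := sq_le_sq' (abs_le.1 hn).1 (abs_le.1 hn).2
    have h5 : dist p q ^ 2 ≤ (dist z p + dist z q) ^ 2 := by
      gcongr
      exact dist_triangle_left p q z
    exact h1.trans (mul_le_mul (by linarith) (by linarith) (by linarith) (by norm_num))
  -- AM–GM makes the bound linear in `l` and `dist p q`, so that it can be summed over arcs.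
  have h5 : l ^ 2 - dist p q ^ 2 ≤ (A * (l - dist p q) + l / (2 * A)) ^ 2 := by
    have h6 : (A * (l - dist p q)) * (l / (2 * A)) = (l - dist p q) * l / 2 := by
      field_simp
    have h7 : 0 ≤ (l - dist p q) ^ 2 := sq_nonneg _
    have h8 := four_mul_le_sq_add (A * (l - dist p q)) (l / (2 * A))
    rw [mul_assoc, h6] at h8
    linarith
  refine (sq_le_sq₀ h (by positivity)).1 ?_
  rw [mul_pow]
  linarith [sq_nonneg (A * (l - dist p q) + l / (2 * A))]

lemma abs_apply_sub_le {p q : Plane} {m n : ℝ} (hm : |m| ≤ 3) (hn : |n| ≤ 3) :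
    |(m * p 0 + n * p 1) - (m * q 0 + n * q 1)| ≤ 6 * dist p q := by
  have h := max_abs_le_length (q 0 - p 0) (q 1 - p 1)
  rw [← Plane.dist_eq_sqrt] at h
  have h0 := (le_max_left _ _).trans h
  have h1 := (le_max_right _ _).trans h
  rw [show (m * p 0 + n * p 1) - (m * q 0 + n * q 1) = -(m * (q 0 - p 0) + n * (q 1 - p 1)) by ring,
    abs_neg]
  refine (abs_add_le _ _).trans ?_
  rw [abs_mul, abs_mul]
  have := mul_le_mul hm h0 (abs_nonneg _) (by norm_num)
  have := mul_le_mul hn h1 (abs_nonneg _) (by norm_num)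
  linarith

/-- The projection of a curve along the lines `m * x + n * y = t`. -/
def PlaneCurve.shadow (β : PlaneCurve) (m n : ℝ) : Set ℝ :=
  range fun τ => m * β τ 0 + n * β τ 1

lemma PlaneCurve.edist_le_length (β : PlaneCurve) (s t : unitInterval) :
    edist (β s) (β t) ≤ β.length :=
  eVariationOn.edist_le _ (mem_univ _) (mem_univ _)

lemma PlaneCurve.volume_shadow_le (β : PlaneCurve) (hβ : β.length ≠ ⊤) {m n : ℝ} (hm : |m| ≤ 3)
    (hn : |n| ≤ 3) : volume (β.shadow m n) ≤ ENNReal.ofReal (12 * β.length.toReal) := by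
  have : β.shadow m n ⊆ Icc (m * β 0 0 + n * β 0 1 - 6 * β.length.toReal)
      (m * β 0 0 + n * β 0 1 + 6 * β.length.toReal) := by
    rintro _ ⟨τ, rfl⟩
    have h1 : dist (β τ) (β 0) ≤ β.length.toReal := by
      rw [dist_edist]
      exact ENNReal.toReal_mono hβ (β.edist_le_length _ _)
    have h2 := abs_le.1 (abs_apply_sub_le (p := β τ) (q := β 0) hm hn)
    constructor <;> linarith
  refine (measure_mono this).trans ?_
  rw [Real.volume_Icc]
  exact ENNReal.ofReal_le_ofReal (by linarith)

/-- A partition of a curve into arcs whose chords have nearly the same total length. -/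
lemma PlaneCurve.exists_partition (β : PlaneCurve) (hβ : β.length ≠ ⊤) {η : ℝ} (hη : 0 < η) :
    ∃ (N : ℕ) (u : ℕ → unitInterval), Monotone u ∧ u 0 = 0 ∧ u N = 1 ∧
      β.length.toReal ≤ ∑ k ∈ Finset.range N, dist (β (u k)) (β (u (k + 1))) + η := by
  rcases eq_or_ne β.length 0 with h0 | h0
  · refine ⟨1, fun k => if k = 0 then 0 else 1, ?_, by simp, by simp, ?_⟩
    · refine monotone_nat_of_le_succ fun k => ?_
      simp only [Nat.add_eq_zero_iff, one_ne_zero, and_false, if_false]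
      exact unitInterval.le_one _
    · rw [h0]
      simp only [ENNReal.toReal_zero]
      positivity
  have hlt : β.length - ENNReal.ofReal η < β.length := by
    refine ENNReal.sub_lt_self hβ h0 ?_
    simpa using hη
  obtain ⟨⟨n, v, hv, _⟩, hlt'⟩ := lt_iSup_iff.1 (show _ < eVariationOn _ _ from hlt)
  -- The near-optimal partition is padded with the endpoints 0 and 1.
  set u : ℕ → unitInterval := fun k => if k = 0 then 0 else if k ≤ n + 1 then v (k - 1) else 1 with hu
  have hmono : Monotone u := by
    refine monotone_nat_of_le_succ fun k => ?_
    simp only [hu, Nat.add_eq_zero_iff, one_ne_zero, and_false, if_false]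
    by_cases hk : k = 0
    · simp only [hk, if_true]; exact unitInterval.nonneg'
    · simp only [hk, if_false]
      split_ifs with h1 h2
      · exact hv (by omega)
      · exact unitInterval.le_one _
      · omega
      · exact le_rfl
  refine ⟨n + 2, u, hmono, by simp [hu], by simp [hu], ?_⟩
  have hsum : ∑ i ∈ Finset.range n, edist (β (v (i + 1))) (β (v i)) ≤
      ∑ k ∈ Finset.range (n + 2), edist (β (u k)) (β (u (k + 1))) := by
    rw [Finset.sum_range_succ, Finset.sum_range_succ']
    refine le_trans (le_of_eq ?_) (le_self_add.trans le_self_add)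
    refine Finset.sum_congr rfl fun i hi => ?_
    have := Finset.mem_range.1 hi
    simp only [hu, Nat.add_eq_zero_iff, one_ne_zero, and_false, if_false]
    rw [if_pos (by omega), if_pos (by omega), edist_comm]
    rfl
  have hle : β.length ≤ ∑ k ∈ Finset.range (n + 2), edist (β (u k)) (β (u (k + 1))) +
      ENNReal.ofReal η := tsub_le_iff_right.1 (hlt'.le.trans hsum)
  have hne : ∀ k ∈ Finset.range (n + 2), edist (β (u k)) (β (u (k + 1))) ≠ ⊤ := fun k _ =>
    edist_ne_top _ _
  have := ENNReal.toReal_mono (ENNReal.add_ne_top.2 ⟨ENNReal.sum_ne_top.2 hne,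
    ENNReal.ofReal_ne_top⟩) hle
  rw [ENNReal.toReal_add (ENNReal.sum_ne_top.2 hne) ENNReal.ofReal_ne_top,
    ENNReal.toReal_sum hne, ENNReal.toReal_ofReal hη.le] at this
  simpa only [dist_edist] using this

/-- A curve of finite length can be replaced by finitely many segments, with a small error. -/
lemma PlaneCurve.exists_polygon (β : PlaneCurve) (hβ : β.length ≠ ⊤) {ε : ℝ} (hε : 0 < ε) :
    ∃ (N : ℕ) (P : ℕ → Plane), ∑ k ∈ Finset.range N, dist (P k) (P (k + 1)) ≤ β.length.toReal ∧
      ∀ m n : ℝ, |m| ≤ 3 → |n| ≤ 3 → volume (β.shadow m n \ ⋃ k ∈ Finset.range N,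
        uIcc (m * P k 0 + n * P k 1) (m * P (k + 1) 0 + n * P (k + 1) 1)) ≤ ENNReal.ofReal ε := by
  set L := β.length.toReal with hL
  have hL0 : 0 ≤ L := ENNReal.toReal_nonneg
  -- `A` is fixed first to make the term `L / (2 * A)` small; only then is the partition refined to
  -- absorb the factor `A` on the chord defect.
  obtain ⟨A, hA, hAε⟩ : ∃ A : ℝ, 0 < A ∧ 6 * (L / (2 * A)) ≤ ε / 2 := by
    refine ⟨6 * (L + 1) / ε, by positivity, ?_⟩
    rw [show 6 * (L / (2 * (6 * (L + 1) / ε))) = (L / (L + 1)) * (ε / 2) by field_simp]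
    have : L / (L + 1) ≤ 1 := by rw [div_le_one (by linarith)]; linarith
    nlinarith
  obtain ⟨N, u, hu, hu0, huN, hsum⟩ := β.exists_partition hβ (η := ε / (12 * A)) (by positivity)
  set l : ℕ → ℝ := fun k => (eVariationOn (fun t => β t) (Icc (u k) (u (k + 1)))).toReal with hl
  have hfin : ∀ k, eVariationOn (fun t => β t) (Icc (u k) (u (k + 1))) ≠ ⊤ := fun k =>
    ne_top_of_le_ne_top hβ (eVariationOn.mono _ (subset_univ _))
  have hlsum : ∑ k ∈ Finset.range N, l k = L := by
    rw [hl, ← ENNReal.toReal_sum fun k _ => hfin k, eVariationOn.sum' _ hu, hu0, huN, hL]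
    congr 2
    exact eq_univ_of_forall fun t => ⟨unitInterval.nonneg', unitInterval.le_one'⟩
  have harc : ∀ k, ∀ t ∈ Icc (u k) (u (k + 1)),
      dist (β t) (β (u k)) + dist (β t) (β (u (k + 1))) ≤ l k := by
    intro k t ht
    have h1 := eVariationOn.Icc_add_Icc (fun t => β t) (s := univ) ht.1 ht.2 (mem_univ _)
    simp only [univ_inter] at h1
    have h2 := eVariationOn.edist_le (fun t => β t) (s := Icc (u k) t)
      (right_mem_Icc.2 ht.1) (left_mem_Icc.2 ht.1)
    have h3 := eVariationOn.edist_le (fun t => β t) (s := Icc t (u (k + 1)))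
      (left_mem_Icc.2 ht.2) (right_mem_Icc.2 ht.2)
    have h4 := ENNReal.toReal_mono (hfin k) ((add_le_add h2 h3).trans_eq h1)
    rwa [ENNReal.toReal_add (edist_ne_top _ _) (edist_ne_top _ _), ← dist_edist, ← dist_edist] at h4
  have hchord : ∀ k, dist (β (u k)) (β (u (k + 1))) ≤ l k := fun k =>
    (dist_triangle_left _ _ _).trans (harc k (u k) (left_mem_Icc.2 (hu (Nat.le_succ k))))
  refine ⟨N, fun k => β (u k), hlsum ▸ Finset.sum_le_sum fun k _ => hchord k, ?_⟩
  intro m n hm hn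
  set p : ℕ → ℝ := fun k => m * β (u k) 0 + n * β (u k) 1 with hp
  set e : ℕ → ℝ := fun k =>
    3 * (A * (l k - dist (β (u k)) (β (u (k + 1)))) + l k / (2 * A)) with he
  have he0 : ∀ k, 0 ≤ e k := fun k => by
    have h1 := mul_nonneg hA.le (sub_nonneg.2 (hchord k))
    have h2 : 0 ≤ l k := dist_nonneg.trans (hchord k)
    simp only [he]
    positivity
  have hcover : β.shadow m n \ (⋃ k ∈ Finset.range N, uIcc (p k) (p (k + 1))) ⊆
      ⋃ k ∈ Finset.range N, (Icc (min (p k) (p (k + 1)) - e k) (max (p k) (p (k + 1)) + e k) \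
        uIcc (p k) (p (k + 1))) := by
    rintro _ ⟨⟨t, rfl⟩, ht⟩
    obtain ⟨k, hk, htk⟩ : ∃ k ∈ Finset.range N, t ∈ Icc (u k) (u (k + 1)) := by
      have hNt : t ≤ u N := huN ▸ unitInterval.le_one'
      classical
      have hex : ∃ j, t ≤ u j := ⟨N, hNt⟩
      rcases Nat.eq_zero_or_pos (Nat.find hex) with h0 | h0
      · have ht0 : t ≤ u 0 := h0 ▸ Nat.find_spec hex
        have hN : N ≠ 0 := by
          rintro rfl
          rw [hu0] at huN
          exact zero_ne_one huN
        exact ⟨0, Finset.mem_range.2 (Nat.pos_of_ne_zero hN),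
          hu0 ▸ unitInterval.nonneg', ht0.trans (hu (Nat.zero_le _))⟩
      · refine ⟨Nat.find hex - 1, Finset.mem_range.2 ?_, ?_, ?_⟩
        · have := Nat.find_min' hex hNt
          omega
        · exact (not_le.1 (Nat.find_min hex (show Nat.find hex - 1 < Nat.find hex by omega))).le
        · rw [Nat.sub_add_cancel h0]
          exact Nat.find_spec hex
    refine mem_biUnion hk ⟨⟨?_, ?_⟩, fun h => ht (mem_biUnion hk h)⟩
    · have := apply_le_max_add (harc k t htk) hA (m := -m) (n := -n) (by rwa [abs_neg])
        (by rwa [abs_neg])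
      rw [show -m * β (u k) 0 + -n * β (u k) 1 = -p k by simp only [hp]; ring,
        show -m * β (u (k + 1)) 0 + -n * β (u (k + 1)) 1 = -p (k + 1) by simp only [hp]; ring,
        max_neg_neg] at this
      simp only [he]
      linarith
    · exact apply_le_max_add (harc k t htk) hA hm hn
  refine (measure_mono hcover).trans ((measure_biUnion_finset_le _ _).trans ?_)
  have hpiece : ∀ k ∈ Finset.range N,
      volume (Icc (min (p k) (p (k + 1)) - e k) (max (p k) (p (k + 1)) + e k) \
        uIcc (p k) (p (k + 1))) ≤ ENNReal.ofReal (2 * e k) := by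
    intro k _
    rw [uIcc, measure_sdiff (Icc_subset_Icc (by linarith [he0 k]) (by linarith [he0 k]))
      measurableSet_Icc.nullMeasurableSet (by simp), Real.volume_Icc,
      Real.volume_Icc, ← ENNReal.ofReal_sub _ (sub_nonneg.2 min_le_max)]
    exact ENNReal.ofReal_le_ofReal (by linarith)
  refine (Finset.sum_le_sum hpiece).trans ?_
  rw [← ENNReal.ofReal_sum_of_nonneg fun k _ => mul_nonneg zero_le_two (he0 k)]
  refine ENNReal.ofReal_le_ofReal ?_
  simp only [he]
  rw [← Finset.mul_sum, ← Finset.mul_sum, Finset.sum_add_distrib, ← Finset.mul_sum,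
    Finset.sum_sub_distrib, ← Finset.sum_div, hlsum]
  have h1 : A * (L - ∑ k ∈ Finset.range N, dist (β (u k)) (β (u (k + 1)))) ≤ ε / 12 := by
    have := mul_le_mul_of_nonneg_left (sub_le_iff_le_add'.2 hsum) hA.le
    rwa [show A * (ε / (12 * A)) = ε / 12 by field_simp] at this
  linarith

/-- A barrier of the unit square meets every line `m * x + n * y = t` that meets the square. -/
lemma IsBarrier.exists_mem_shadow {ι : Type*} {β : ι → PlaneCurve}
    (hbar : IsBarrier (curveUnion β) unitSquare) {m n t : ℝ} (hmn : m ≠ 0 ∨ n ≠ 0)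
    (ht : t ∈ Icc (-(|m| + |n|) / 2) ((|m| + |n|) / 2)) : ∃ i, t ∈ (β i).shadow m n := by
  have hpos : 0 < |m| + |n| := by
    rcases hmn with h | h
    · have := abs_pos.2 h; positivity
    · have := abs_pos.2 h; positivity
  set r := t / (|m| + |n|) with hr
  have hr' : |r| ≤ 1 / 2 := by
    rw [hr, abs_div, abs_of_pos hpos, div_le_iff₀ hpos, abs_le]
    constructor <;> linarith [ht.1, ht.2]
  have hsgn : ∀ a : ℝ, ∃ s : ℝ, |s| = 1 ∧ a * s = |a| := fun a => by
    rcases le_total 0 a with h | h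
    · exact ⟨1, by simp, by rw [abs_of_nonneg h, mul_one]⟩
    · exact ⟨-1, by simp, by rw [abs_of_nonpos h]; ring⟩
  obtain ⟨s, hs, hms⟩ := hsgn m
  obtain ⟨s', hs', hns⟩ := hsgn n
  -- The functional takes its maximum over the square at half the sign vector `(s, s')`, so the line
  -- meets the diagonal through that corner inside the square.
  set p : Plane := !₂[r * s, r * s'] with hp
  set v : Plane := !₂[-n, m] with hv
  have hv0 : v ≠ 0 := by
    intro h
    have h0 := congrFun (congrArg WithLp.ofLp h) 0
    have h1 := congrFun (congrArg WithLp.ofLp h) 1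
    simp [hv] at h0 h1
    rcases hmn with h | h
    · exact h h1
    · exact h h0
  obtain ⟨z, hz, hzB⟩ := hbar (AffineSubspace.mk' p (Submodule.span ℝ {v}))
    (by rw [IsStraightLine, AffineSubspace.direction_mk', finrank_span_singleton hv0])
    ⟨p, AffineSubspace.self_mem_mk' _ _, by
      simp [unitSquare, hp, abs_mul, hs, hs']
      simpa using hr'⟩
  obtain ⟨i, τ, rfl⟩ := mem_iUnion.1 hzB
  refine ⟨i, τ, ?_⟩
  rw [SetLike.mem_coe, AffineSubspace.mem_mk', Submodule.mem_span_singleton] at hz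
  obtain ⟨c, hc⟩ := hz
  have h0 := congrFun (congrArg WithLp.ofLp hc) 0
  have h1 := congrFun (congrArg WithLp.ofLp hc) 1
  simp [hv, hp] at h0 h1
  have e0 : β i τ 0 = r * s - c * n := by linarith
  have e1 : β i τ 1 = r * s' + c * m := by linarith
  simp only [e0, e1]
  have : r * (|m| + |n|) = t := by rw [hr]; field_simp
  rw [← this, ← hms, ← hns]
  ring

/-- A rectifiable barrier of the unit square can be replaced by finitely many segments which are
nearly a barrier. -/
lemma IsRectifiableFamily.exists_isNearBarrier {ι : Type u} [Countable ι] {β : ι → PlaneCurve}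
    (hrect : IsRectifiableFamily β) (hbar : IsBarrier (curveUnion β) unitSquare) {ε : ℝ}
    (hε : 0 < ε) : ∃ (κ : Type u) (_ : Fintype κ) (x₀ y₀ x₁ y₁ : κ → ℝ),
      IsNearBarrier x₀ y₀ x₁ y₁ ε ∧
        ∑ k, √((x₁ k - x₀ k) ^ 2 + (y₁ k - y₀ k) ^ 2) ≤ totalLength β := by
  classical
  obtain ⟨hfin, hsumm⟩ := hrect
  -- A shadow measures at most 12 times the length of its curve, so the tail costs at most `ε / 2`.
  obtain ⟨F, hF⟩ : ∃ F : Finset ι, ∑' i : {i // i ∉ F}, (β i).length.toReal ≤ ε / 24 := by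
    have := tendsto_tsum_compl_atTop_zero fun i => (β i).length.toReal
    exact ((this.eventually (ge_mem_nhds (show (0 : ℝ) < ε / 24 by positivity))).exists)
  choose N P hlen hP using fun i => (β i).exists_polygon (hfin i)
    (ε := ε / (2 * (F.card + 1))) (by positivity)
  refine ⟨Σ i : F, Fin (N i), inferInstance, fun k => P k.1 k.2 0, fun k => P k.1 k.2 1,
    fun k => P k.1 (k.2 + 1) 0, fun k => P k.1 (k.2 + 1) 1, ?_, ?_⟩
  · intro m n hm hn hmn
    set seg : ι → ℕ → Set ℝ := fun i k =>
      uIcc (m * P i k 0 + n * P i k 1) (m * P i (k + 1) 0 + n * P i (k + 1) 1) with hseg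
    have hsub : Icc (-(|m| + |n|) / 2) ((|m| + |n|) / 2) \
        (⋃ k : Σ i : F, Fin (N i), seg k.1 k.2) ⊆
        (⋃ i ∈ F, (β i).shadow m n \ ⋃ k ∈ Finset.range (N i), seg i k) ∪
          ⋃ i : {i // i ∉ F}, (β i).shadow m n := by
      rintro t ⟨ht, ht'⟩
      obtain ⟨i, hi⟩ := hbar.exists_mem_shadow hmn ht
      by_cases hiF : i ∈ F
      · refine Or.inl (mem_biUnion hiF ⟨hi, fun h => ht' ?_⟩)
        simp only [mem_iUnion, Finset.mem_range] at h
        obtain ⟨k, hk, htk⟩ := h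
        exact mem_iUnion.2 ⟨⟨⟨i, hiF⟩, ⟨k, hk⟩⟩, htk⟩
      · exact Or.inr (mem_iUnion.2 ⟨⟨i, hiF⟩, hi⟩)
    have h1 : volume (⋃ i ∈ F, (β i).shadow m n \ ⋃ k ∈ Finset.range (N i), seg i k) ≤
        ENNReal.ofReal (ε / 2) := by
      refine (measure_biUnion_finset_le _ _).trans
        ((Finset.sum_le_sum fun i _ => hP i m n hm hn).trans ?_)
      rw [Finset.sum_const, nsmul_eq_mul, ← ENNReal.ofReal_natCast, ← ENNReal.ofReal_mul (by positivity)]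
      refine ENNReal.ofReal_le_ofReal ?_
      rw [show (F.card : ℝ) * (ε / (2 * (F.card + 1))) = (F.card / (F.card + 1)) * (ε / 2) by
        field_simp]
      have : (F.card : ℝ) / (F.card + 1) ≤ 1 := by
        rw [div_le_one (by positivity)]; linarith
      nlinarith
    have h2 : volume (⋃ i : {i // i ∉ F}, (β i).shadow m n) ≤ ENNReal.ofReal (ε / 2) := by
      refine (measure_iUnion_le _).trans
        ((ENNReal.tsum_le_tsum fun i : {i // i ∉ F} => (β i).volume_shadow_le (hfin i) hm hn).trans ?_)
      have hs : Summable fun i : {i // i ∉ F} => (β i).length.toReal := hsumm.subtype _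
      rw [← ENNReal.ofReal_tsum_of_nonneg (fun i => by positivity) (hs.mul_left 12), tsum_mul_left]
      exact ENNReal.ofReal_le_ofReal (by linarith)
    have h3 := (measure_mono hsub).trans ((measure_union_le _ _).trans (add_le_add h1 h2))
    rw [← ENNReal.ofReal_add (by positivity) (by positivity), add_halves] at h3
    exact ENNReal.toReal_le_of_le_ofReal hε.le h3
  · rw [Fintype.sum_sigma]
    calc _ = ∑ i : F, ∑ k ∈ Finset.range (N i), dist (P i k) (P i (k + 1)) := by
          refine Finset.sum_congr rfl fun i _ => ?_
          rw [← Fin.sum_univ_eq_sum_range (fun k => dist (P i k) (P i (k + 1)))]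
          exact Finset.sum_congr rfl fun k _ => (Plane.dist_eq_sqrt _ _).symm
      _ ≤ ∑ i : F, (β i).length.toReal := Finset.sum_le_sum fun i _ => hlen i
      _ = ∑ i ∈ F, (β i).length.toReal := Finset.sum_coe_sort F fun i => (β i).length.toReal
      _ ≤ _ := hsumm.sum_le_tsum F fun i _ => ENNReal.toReal_nonneg

end Reduction

theorem mainTheorem1 {ι : Type*} [Countable ι] (β : ι → PlaneCurve)
    (hrect : IsRectifiableFamily β) (hbar : IsBarrier (curveUnion β) unitSquare) :
    (2.00002 : ℝ) ≤ totalLength β := by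
  obtain ⟨κ, _, x₀, y₀, x₁, y₁, hnear, hlen⟩ :=
    hrect.exists_isNearBarrier hbar (ε := 1e-7) (by norm_num)
  exact hnear.length_gt.le.trans hlen
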